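/- Let $M$ be a connected smooth manifold (finite-dimensional, Hausdorff, second countable, without boundary), let $\alpha$ be a smooth Riemannian metric on $M$, let $\beta$ be a smooth one-form on $M$ with $\|\beta\|_\alpha=1$ at every point (the Finsleroid axis one-form), and let $K\colon M\to(-4,4)$ be a smooth function (the Finsleroid charge). For a tangent vector $v$ write $\alpha^2=\alpha(v,v)$, $\beta=\beta(v)$, and let $F\ge 0$ be the Finsleroid-Finsler metric on $TM$ given by $$\frac12F(v)^2=\frac{1}{2}\left(\alpha^2+\frac{K}{2}\,\beta\sqrt{\alpha^2-\beta^2}\right)\exp\left(\frac{2K}{\sqrt{16-K^2}}\arctan\left(\frac{1}{\sqrt{16-K^2}}\left(\frac{4\beta}{\sqrt{\alpha^2-\beta^2}}+K\right)\right)\right),$$ where for nonzero $v$ with $\alpha^2=\beta^2$ the arctangent is replaced by its limit $\pm\frac{\pi}{2}$, the sign being that of $\beta(v)$, and $F(0)=0$. Then the following are equivalent: (1) $(M,F)$ is a generalized Berwald space, i.e. there is a smooth linear connection on $M$ whose parallel transports along all smooth curves preserve $F$; (2) $K$ is constant on $M$. -/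

import Mathlib

open Set Bundle
open scoped Manifold ContDiff

noncomputable section

namespace Finsleroid

section Connection

variable {n : ℕ} {M : Type*} [TopologicalSpace M] [ChartedSpace (EuclideanSpace ℝ (Fin n)) M]
  [IsManifold (𝓡 n) ∞ M]

/-- A linear connection on the base manifold `M`: a covariant derivative on the tangent bundle. -/
abbrev LinearConnection (n : ℕ) (M : Type*) [TopologicalSpace M]
    [ChartedSpace (EuclideanSpace ℝ (Fin n)) M] [IsManifold (𝓡 n) ∞ M] :=
  CovariantDerivative (𝓡 n) (EuclideanSpace ℝ (Fin n)) (TangentSpace (𝓡 n) : M → Type _)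

/-- The velocity at time `t` of a curve `γ` defined on the set `s` of times. -/
def velocity (γ : ℝ → M) (s : Set ℝ) (t : ℝ) : TangentSpace (𝓡 n) (γ t) :=
  mfderivWithin 𝓘(ℝ, ℝ) (𝓡 n) γ s t (1 : ℝ)

/-- The covariant derivative at time `t` of a vector field `V` along the curve `γ`.
In the local frame `e₁, …, eₙ` of the tangent bundle given by the preferred trivialization at the
point `γ t`, write `V r = ∑ Vⁱ(r) eᵢ(γ r)` for `r` near `t`. The value is
`∑ (Vⁱ)'(t) eᵢ(γ t) + ∇_{γ'(t)} (∑ Vⁱ(t) eᵢ)`, where in the second term `∑ Vⁱ(t) eᵢ` is the local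
vector field whose components are constant, equal to those of `V t`. -/
def covDerivAlong (cov : LinearConnection n M) (γ : ℝ → M)
    (V : (t : ℝ) → TangentSpace (𝓡 n) (γ t)) (s : Set ℝ) (t : ℝ) : TangentSpace (𝓡 n) (γ t) :=
  let e := trivializationAt (EuclideanSpace ℝ (Fin n)) (TangentSpace (𝓡 n) : M → Type _) (γ t)
  let comp : ℝ → EuclideanSpace ℝ (Fin n) := fun r => (e (⟨γ r, V r⟩ : TangentBundle (𝓡 n) M)).2
  e.symm (γ t) (derivWithin comp s t) + cov (fun x => e.symm x (comp t)) (γ t) (velocity γ s t)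

/-- The vector field `V` along the curve `γ` is differentiable and parallel at the times in `s`. -/
structure IsParallelOn (cov : LinearConnection n M) (γ : ℝ → M)
    (V : (t : ℝ) → TangentSpace (𝓡 n) (γ t)) (s : Set ℝ) : Prop where
  mdifferentiableOn :
    MDifferentiableOn 𝓘(ℝ, ℝ) (𝓡 n).tangent
      (fun t => (⟨γ t, V t⟩ : TangentBundle (𝓡 n) M)) s
  covDerivAlong_eq_zero : ∀ t ∈ s, covDerivAlong cov γ V s t = 0

/-- The tangent vector `w` at `γ b` is the parallel translate along `γ : [a, b] → M` of the tangent
vector `v` at `γ a`. -/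
def IsParallelTranslate (cov : LinearConnection n M) (γ : ℝ → M) (a b : ℝ)
    (v : TangentSpace (𝓡 n) (γ a)) (w : TangentSpace (𝓡 n) (γ b)) : Prop :=
  ∃ V : (t : ℝ) → TangentSpace (𝓡 n) (γ t), IsParallelOn cov γ V (Icc a b) ∧ V a = v ∧ V b = w

/-- A linear connection is compatible with a Finsler norm `F` on the tangent spaces if its parallel
transports along smooth curves preserve the `F`-length of tangent vectors. -/
def IsCompatible (cov : LinearConnection n M) (F : (x : M) → TangentSpace (𝓡 n) x → ℝ) : Prop :=
  ∀ (γ : ℝ → M) (a b : ℝ), a < b → ContMDiffOn 𝓘(ℝ, ℝ) (𝓡 n) ∞ γ (Icc a b) →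
    ∀ (v : TangentSpace (𝓡 n) (γ a)) (w : TangentSpace (𝓡 n) (γ b)),
      IsParallelTranslate cov γ a b v w → F (γ b) w = F (γ a) v

/-- Generalized Berwald spaces: there is a (smooth) linear connection on the base manifold which is
compatible with the Finsler norm. -/
def IsGeneralizedBerwald (F : (x : M) → TangentSpace (𝓡 n) x → ℝ) : Prop :=
  ∃ cov : LinearConnection n M,
    CovariantDerivative.ContMDiffCovariantDerivative cov ∞ ∧ IsCompatible cov F

end Connection

/-- The Finsleroid energy as a function of the charge `K`, of `A = α²` and of `β`, where
`q = √(α² - β²)`. On the axis `q = 0` the arctangent is replaced by its limit `± π / 2` as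
`q → 0+`, the sign being that of `β`. -/
def finsleroidEnergy (K A β : ℝ) : ℝ :=
  let q := √(A - β ^ 2)
  let h := √(16 - K ^ 2)
  1 / 2 * (A + K / 2 * β * q) *
    Real.exp (2 * K / h *
      (if q = 0 then SignType.sign β * (Real.pi / 2) else Real.arctan (1 / h * (4 * β / q + K))))

/-- The data of a Finsleroid-Finsler space on the manifold `M`: a Riemannian metric `α`, a smooth
one-form `β` of unit length with respect to `α` (the Finsleroid axis one-form), and a smooth
function `K` with values in `(-4, 4)` (the Finsleroid charge). -/
structure FinsleroidSpace (n : ℕ) (M : Type*) [TopologicalSpace M]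
    [ChartedSpace (EuclideanSpace ℝ (Fin n)) M] [IsManifold (𝓡 n) ∞ M] where
  /-- the Riemannian metric -/
  metric : ContMDiffRiemannianMetric (𝓡 n) ∞ (EuclideanSpace ℝ (Fin n))
    (TangentSpace (𝓡 n) : M → Type _)
  /-- the axis one-form -/
  axis : (x : M) → TangentSpace (𝓡 n) x →L[ℝ] ℝ
  contMDiff_axis : ContMDiff (𝓡 n) ((𝓡 n).prod 𝓘(ℝ, EuclideanSpace ℝ (Fin n) →L[ℝ] ℝ)) ∞
    (fun x => TotalSpace.mk' (EuclideanSpace ℝ (Fin n) →L[ℝ] ℝ)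
      (E := fun x : M => TangentSpace (𝓡 n) x →L[ℝ] Bundle.Trivial M ℝ x) x (axis x))
  /-- The vector `u` metrically dual to the axis one-form is a unit vector. -/
  unit_axis : ∀ x, ∃ u : TangentSpace (𝓡 n) x,
    (∀ v, axis x v = metric.inner x u v) ∧ metric.inner x u u = 1
  /-- the charge -/
  charge : M → ℝ
  contMDiff_charge : ContMDiff (𝓡 n) 𝓘(ℝ, ℝ) ∞ charge
  neg_four_lt_charge : ∀ x, -4 < charge x
  charge_lt_four : ∀ x, charge x < 4

namespace FinsleroidSpace

variable {n : ℕ} {M : Type*} [TopologicalSpace M] [ChartedSpace (EuclideanSpace ℝ (Fin n)) M]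
  [IsManifold (𝓡 n) ∞ M]

/-- The Finsler energy `E` of a Finsleroid-Finsler space. -/
def energy (S : FinsleroidSpace n M) (x : M) (v : TangentSpace (𝓡 n) x) : ℝ :=
  finsleroidEnergy (S.charge x) (S.metric.inner x v v) (S.axis x v)

/-- The Finsleroid-Finsler metric `F`, with `E = F² / 2` and `F ≥ 0`. -/
def norm (S : FinsleroidSpace n M) (x : M) (v : TangentSpace (𝓡 n) x) : ℝ :=
  √(2 * S.energy x v)

end FinsleroidSpace

end Finsleroid

end

/-! Necessity rests on the asymmetry of the energy `E`. With `q = √(α² - β²)` and `t = β / q`, the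
logarithm of `E(v) / E(-v)` is a function of `t` alone. It is monotone in `t`, and its limits at
`±∞` are its values on the axis, `±2πK / √(16 - K²)`. Hence the ratio is extremal at `±u`, where `u`
is the unit vector dual to `β`, and the extreme value determines `|K|`.

A compatible connection transports `u` at `x` to some `w` at `y` and, by linearity, `-u` to `-w`.
The extreme ratio at `x` therefore occurs at `y`, so `|K(x)| ≤ |K(y)|` (`abs_charge_le_of_norm_eq`).
Points of a small chart ball are joined by segments in both directions, so `|K|` is locally
constant. On a connected manifold the continuous function `K` then takes values in `{c, -c}` and is
constant. Transport is only needed along segments so short that one application of Picard-Lindelöf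
solves the equation (`exists_solution_of_norm_le_half`).

For sufficiency, if `K` is constant it is enough to find a smooth connection with `∇α = 0` and `∇β =
0` (`exists_connection`). Locally it comes from a frame adapted to `β`. Both conditions survive
weighted averages with total weight one, so a partition of unity makes it global. Along a parallel
field `α(V, V)` and `β(V)` are constant, and `F` depends on nothing else. -/

namespace Finsleroid

/-! ### Asymmetry of the Finsleroid energy under `v ↦ -v`. -/

section Energy

open Filter Topology

lemma sqrt_sixteen_sub_sq_pos {K : ℝ} (hK : |K| < 4) : 0 < √(16 - K ^ 2) := by
  apply Real.sqrt_pos.2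
  have := sq_lt_sq' (by linarith [abs_nonneg K]) hK
  rw [sq_abs] at this
  linarith

lemma one_add_sq_add_pos {K : ℝ} (hK : |K| < 4) (t : ℝ) : 0 < 1 + t ^ 2 + K / 2 * t := by
  have := sq_lt_sq' (by linarith [abs_nonneg K]) hK
  rw [sq_abs] at this
  nlinarith [sq_nonneg (t + K / 4)]

lemma finsleroidEnergy_neg (K A β : ℝ) :
    finsleroidEnergy (-K) A (-β) = finsleroidEnergy K A β := by
  unfold finsleroidEnergy
  simp only [even_two.neg_pow]
  congr 2
  · ring
  · split_ifs with hq
    · rcases lt_trichotomy β 0 with hβ | hβ | hβ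
      · simp [hβ]; ring
      · simp [hβ]
      · simp [hβ]; ring
    · rw [show 1 / √(16 - K ^ 2) * (4 * -β / √(A - β ^ 2) + -K)
        = -(1 / √(16 - K ^ 2) * (4 * β / √(A - β ^ 2) + K)) by ring, Real.arctan_neg]
      ring

lemma finsleroidEnergy_one_one (K : ℝ) :
    finsleroidEnergy K 1 1 = 1 / 2 * Real.exp (K * Real.pi / √(16 - K ^ 2)) := by
  simp only [finsleroidEnergy]
  norm_num
  ring

lemma finsleroidEnergy_one_neg_one (K : ℝ) :
    finsleroidEnergy K 1 (-1) = 1 / 2 * Real.exp (-(K * Real.pi / √(16 - K ^ 2))) := by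
  rw [← finsleroidEnergy_neg, neg_neg, finsleroidEnergy_one_one]
  simp [neg_div]

lemma finsleroidEnergy_nonneg {K A β : ℝ} (hK : |K| < 4) (h : β ^ 2 ≤ A) :
    0 ≤ finsleroidEnergy K A β := by
  unfold finsleroidEnergy
  have hq : √(A - β ^ 2) ^ 2 = A - β ^ 2 := Real.sq_sqrt (by linarith)
  have h1 := abs_lt.1 hK
  -- With `q = √(A - β²)`, eight times the right-hand side is `(4 + K)(β + q)² + (4 - K)(β - q)²`.
  have : 0 ≤ A + K / 2 * β * √(A - β ^ 2) := by
    nlinarith [mul_nonneg (by linarith : 0 ≤ 4 + K) (sq_nonneg (β + √(A - β ^ 2))),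
      mul_nonneg (by linarith : 0 ≤ 4 - K) (sq_nonneg (β - √(A - β ^ 2)))]
  dsimp only
  positivity


/-- In the variable `t = β / q` this function is `log (2E / q²)`, see `finsleroidEnergy_eq_exp`. -/
lemma hasDerivAt_log_add_arctan {K : ℝ} (hK : |K| < 4) (t : ℝ) :
    HasDerivAt (fun t : ℝ => Real.log (1 + t ^ 2 + K / 2 * t) +
        2 * K / √(16 - K ^ 2) * Real.arctan (1 / √(16 - K ^ 2) * (4 * t + K)))
      ((2 * t + K) / (1 + t ^ 2 + K / 2 * t)) t := by
  have hh := sqrt_sixteen_sub_sq_pos hK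
  have hsq : √(16 - K ^ 2) ^ 2 = 16 - K ^ 2 :=
    Real.sq_sqrt (Real.sqrt_pos.1 hh).le
  have hp := one_add_sq_add_pos hK t
  have h1 : HasDerivAt (fun t : ℝ => 1 + t ^ 2 + K / 2 * t) (2 * t + K / 2) t := by
    simpa using ((hasDerivAt_pow 2 t).const_add 1).fun_add ((hasDerivAt_id t).const_mul (K / 2))
  have h2 : HasDerivAt (fun t : ℝ => 1 / √(16 - K ^ 2) * (4 * t + K))
      (1 / √(16 - K ^ 2) * 4) t := by
    simpa using (((hasDerivAt_id t).const_mul 4).add_const K).const_mul (1 / √(16 - K ^ 2))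
  refine ((h1.log hp.ne').add (h2.arctan.const_mul (2 * K / √(16 - K ^ 2)))).congr_deriv ?_
  generalize √(16 - K ^ 2) = h at *
  have h3 : 1 + (1 / h * (4 * t + K)) ^ 2 = 16 * (1 + t ^ 2 + K / 2 * t) / h ^ 2 := by
    field_simp
    rw [hsq]
    ring
  rw [h3]
  field_simp
  ring

/-- The logarithms cancel in the limit, both growing like `2 log t`, while the arctangents tend to
`±π / 2`. The limit is the logarithm of `E(u) / E(-u)` on the axis. -/
lemma tendsto_log_ratio_add_arctan {K : ℝ} (hK : |K| < 4) :
    Tendsto (fun t : ℝ => (Real.log (1 + t ^ 2 + K / 2 * t) +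
        2 * K / √(16 - K ^ 2) * Real.arctan (1 / √(16 - K ^ 2) * (4 * t + K))) -
      (Real.log (1 + (-t) ^ 2 + K / 2 * (-t)) +
        2 * K / √(16 - K ^ 2) * Real.arctan (1 / √(16 - K ^ 2) * (4 * (-t) + K)))) atTop
      (𝓝 (2 * K / √(16 - K ^ 2) * Real.pi)) := by
  have hh := sqrt_sixteen_sub_sq_pos hK
  have hlim (s : ℝ) : Tendsto (fun t : ℝ => 1 + s * t⁻¹ + t⁻¹ ^ 2) atTop (𝓝 1) := by
    simpa using ((tendsto_inv_atTop_zero.const_mul s).const_add (1 : ℝ)).add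
      ((tendsto_inv_atTop_zero (𝕜 := ℝ)).pow 2)
  have hlog : Tendsto (fun t : ℝ => Real.log (1 + K / 2 * t⁻¹ + t⁻¹ ^ 2) -
      Real.log (1 + -(K / 2) * t⁻¹ + t⁻¹ ^ 2)) atTop (𝓝 0) := by
    simpa using ((hlim (K / 2)).log one_ne_zero).sub ((hlim (-(K / 2))).log one_ne_zero)
  have hlin : Tendsto (fun t : ℝ => 1 / √(16 - K ^ 2) * (4 * t + K)) atTop atTop := by
    refine Tendsto.const_mul_atTop (by positivity) ?_
    exact tendsto_atTop_add_const_right _ _ (tendsto_id.const_mul_atTop (by norm_num))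
  have hlin' : Tendsto (fun t : ℝ => 1 / √(16 - K ^ 2) * (4 * (-t) + K)) atTop atBot := by
    refine Tendsto.const_mul_atBot (by positivity) ?_
    exact tendsto_atBot_add_const_right _ _
      (tendsto_neg_atTop_atBot.const_mul_atBot (by norm_num))
  have h1 := (Real.tendsto_arctan_atTop.mono_right nhdsWithin_le_nhds).comp hlin
  have h2 := (Real.tendsto_arctan_atBot.mono_right nhdsWithin_le_nhds).comp hlin'
  have h3 := hlog.add ((h1.sub h2).const_mul (2 * K / √(16 - K ^ 2)))
  have hval : 0 + 2 * K / √(16 - K ^ 2) * (Real.pi / 2 - -(Real.pi / 2)) =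
      2 * K / √(16 - K ^ 2) * Real.pi := by ring
  rw [hval] at h3
  refine h3.congr' ?_
  filter_upwards [eventually_gt_atTop 0] with t ht
  have e1 : 1 + K / 2 * t⁻¹ + t⁻¹ ^ 2 = (1 + t ^ 2 + K / 2 * t) / t ^ 2 := by field_simp; ring
  have e2 : 1 + -(K / 2) * t⁻¹ + t⁻¹ ^ 2 = (1 + (-t) ^ 2 + K / 2 * (-t)) / t ^ 2 := by
    field_simp; ring
  rw [e1, e2, Real.log_div (one_add_sq_add_pos hK t).ne' (by positivity),
    Real.log_div (one_add_sq_add_pos hK (-t)).ne' (by positivity)]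
  simp only [Function.comp]
  ring

/-- With `p(t) = 1 + t² + K t / 2`, the left-hand side has derivative `2K / (p(t) p(-t)) ≥ 0`, so it
is bounded by its limit at infinity. -/
lemma log_ratio_add_arctan_le {K : ℝ} (hK : |K| < 4) (h0 : 0 ≤ K) (t : ℝ) :
    (Real.log (1 + t ^ 2 + K / 2 * t) +
        2 * K / √(16 - K ^ 2) * Real.arctan (1 / √(16 - K ^ 2) * (4 * t + K))) -
      (Real.log (1 + (-t) ^ 2 + K / 2 * (-t)) +
        2 * K / √(16 - K ^ 2) * Real.arctan (1 / √(16 - K ^ 2) * (4 * (-t) + K))) ≤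
      2 * K / √(16 - K ^ 2) * Real.pi := by
  refine Monotone.ge_of_tendsto ?_ (tendsto_log_ratio_add_arctan hK) t
  have hd (t : ℝ) := (hasDerivAt_log_add_arctan hK t).sub
    ((hasDerivAt_log_add_arctan hK (-t)).scomp t (hasDerivAt_neg t))
  refine monotone_of_deriv_nonneg (fun t => (hd t).differentiableAt) fun t => ?_
  refine le_of_le_of_eq ?_ (hd t).deriv.symm
  have h1 := one_add_sq_add_pos hK t
  have h2 := one_add_sq_add_pos hK (-t)
  have : (2 * t + K) / (1 + t ^ 2 + K / 2 * t) -
      (-1 : ℝ) • ((2 * -t + K) / (1 + (-t) ^ 2 + K / 2 * -t)) =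
      2 * K / ((1 + t ^ 2 + K / 2 * t) * (1 + (-t) ^ 2 + K / 2 * -t)) := by
    rw [smul_eq_mul, neg_one_mul, sub_neg_eq_add, div_add_div _ _ h1.ne' h2.ne']
    congr 1
    ring
  rw [this]
  positivity

lemma finsleroidEnergy_eq_exp {K A β : ℝ} (hK : |K| < 4) (h : β ^ 2 < A) :
    finsleroidEnergy K A β = 1 / 2 * (A - β ^ 2) *
      Real.exp (Real.log (1 + (β / √(A - β ^ 2)) ^ 2 + K / 2 * (β / √(A - β ^ 2))) +
        2 * K / √(16 - K ^ 2) *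
          Real.arctan (1 / √(16 - K ^ 2) * (4 * (β / √(A - β ^ 2)) + K))) := by
  have hq : 0 < √(A - β ^ 2) := Real.sqrt_pos.2 (by linarith)
  have hqq : A = √(A - β ^ 2) ^ 2 + β ^ 2 := by rw [Real.sq_sqrt (by linarith)]; ring
  rw [Real.exp_add, Real.exp_log (one_add_sq_add_pos hK _)]
  simp only [finsleroidEnergy, hq.ne', if_false, mul_div_assoc, ← mul_assoc]
  congr 1
  generalize √(A - β ^ 2) = q at *
  rw [hqq]
  field_simp
  ring

lemma finsleroidEnergy_le_of_nonneg {K A β : ℝ} (hK : |K| < 4) (h0 : 0 ≤ K)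
    (h : β ^ 2 ≤ A) :
    finsleroidEnergy K A β ≤
      Real.exp (2 * K / √(16 - K ^ 2) * Real.pi) * finsleroidEnergy K A (-β) := by
  have hh := sqrt_sixteen_sub_sq_pos hK
  rcases h.eq_or_lt with h | h
  -- On the axis the variable `t` is infinite, so this case is computed from the prescribed limit of
  -- the arctangent.
  · subst h
    simp only [finsleroidEnergy, even_two.neg_pow, sub_self, Real.sqrt_zero, if_true, mul_zero,
      add_zero]
    rw [mul_left_comm (Real.exp _), ← Real.exp_add, ← mul_add]
    gcongr
    rcases lt_trichotomy β 0 with hβ | hβ | hβ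
    · simp [hβ]; linarith [Real.pi_pos]
    · simp [hβ]; linarith [Real.pi_pos]
    · simp [hβ]
  · rw [finsleroidEnergy_eq_exp hK h, finsleroidEnergy_eq_exp hK (by simpa using h),
      mul_left_comm, ← Real.exp_add]
    simp only [even_two.neg_pow, neg_div]
    have hA : 0 < A - β ^ 2 := by linarith
    refine mul_le_mul_of_nonneg_left (Real.exp_le_exp.2 ?_) (by positivity)
    have := log_ratio_add_arctan_le hK h0 (β / √(A - β ^ 2))
    simp only [even_two.neg_pow] at this
    linarith

/-- The energies of opposite vectors differ at most by the factor `exp (2π|K| / √(16 - K²))`. -/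
lemma finsleroidEnergy_le {K A β : ℝ} (hK : |K| < 4) (h : β ^ 2 ≤ A) :
    finsleroidEnergy K A β ≤
      Real.exp (2 * |K| / √(16 - K ^ 2) * Real.pi) * finsleroidEnergy K A (-β) := by
  rcases le_total 0 K with h0 | h0
  · rw [abs_of_nonneg h0]
    exact finsleroidEnergy_le_of_nonneg hK h0 h
  · rw [abs_of_nonpos h0, ← finsleroidEnergy_neg K A β, ← finsleroidEnergy_neg K A (-β)]
    have := finsleroidEnergy_le_of_nonneg (K := -K) (β := -β) (A := A) (by rwa [abs_neg])
      (by linarith) (by simpa using h)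
    simpa using this

/-- The function `r ↦ r / √(16 - r²)` is strictly increasing on `[0, 4)`, so the extreme ratio
determines `|K|`. -/
lemma abs_le_abs_of_div_sqrt_le {K L : ℝ} (hK : |K| < 4)
    (h : |K| / √(16 - K ^ 2) ≤ |L| / √(16 - L ^ 2)) : |K| ≤ |L| := by
  by_contra! hlt
  refine absurd h (not_le.2 ?_)
  have h2 : L ^ 2 ≤ K ^ 2 := sq_le_sq.2 hlt.le
  have h1 := sqrt_sixteen_sub_sq_pos hK
  calc |L| / √(16 - L ^ 2) ≤ |L| / √(16 - K ^ 2) := by gcongr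
    _ < |K| / √(16 - K ^ 2) := by gcongr

/-- If the energies of `± u`, where `u` is the axis vector of a Finsleroid of charge `K`, are the
energies of opposite vectors of a Finsleroid of charge `L`, then `|K| ≤ |L|`. -/
lemma abs_charge_le_of_finsleroidEnergy_eq {K L A β : ℝ} (hK : |K| < 4) (hL : |L| < 4)
    (h : β ^ 2 ≤ A) (h1 : finsleroidEnergy L A β = finsleroidEnergy K 1 1)
    (h2 : finsleroidEnergy L A (-β) = finsleroidEnergy K 1 (-1)) : |K| ≤ |L| := by
  -- The bound is applied to both orders of the opposite vectors, since the sign of `K` is not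
  -- known.
  have e1 := finsleroidEnergy_le hL h
  have e2 := finsleroidEnergy_le (β := -β) hL (by simpa using h)
  rw [neg_neg] at e2
  rw [h1, h2, finsleroidEnergy_one_one, finsleroidEnergy_one_neg_one, mul_left_comm,
    ← Real.exp_add] at e1 e2
  have f1 := Real.exp_le_exp.1 (le_of_mul_le_mul_left e1 (by norm_num))
  have f2 := Real.exp_le_exp.1 (le_of_mul_le_mul_left e2 (by norm_num))
  refine abs_le_abs_of_div_sqrt_le hK ?_
  have h3 : |K / √(16 - K ^ 2)| ≤ |L| / √(16 - L ^ 2) := by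
    refine abs_le.2 ⟨?_, ?_⟩ <;>
    · refine le_of_mul_le_mul_right ?_ Real.pi_pos
      rw [mul_div_right_comm, mul_div_assoc] at f1 f2
      linarith
  rwa [abs_div, abs_of_pos (sqrt_sixteen_sub_sq_pos hK)] at h3

end Energy

/-! ### Connections in a local trivialization: Christoffel symbols. -/

section Trivialization

open Filter Topology

variable {n : ℕ} {M : Type*} [TopologicalSpace M] [ChartedSpace (EuclideanSpace ℝ (Fin n)) M]
  [IsManifold (𝓡 n) ∞ M]

/-- The vector field `σ` is differentiable at `x`. -/
abbrev FieldDifferentiableAt (σ : (x : M) → TangentSpace (𝓡 n) x) (x : M) : Prop :=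
  MDifferentiableAt (𝓡 n) ((𝓡 n).prod 𝓘(ℝ, EuclideanSpace ℝ (Fin n)))
    (fun y => (⟨y, σ y⟩ : TangentBundle (𝓡 n) M)) x

/-- The vector field `σ` is smooth at `x`. -/
abbrev FieldSmoothAt (σ : (x : M) → TangentSpace (𝓡 n) x) (x : M) : Prop :=
  ContMDiffAt (𝓡 n) ((𝓡 n).prod 𝓘(ℝ, EuclideanSpace ℝ (Fin n))) ∞
    (fun y => (⟨y, σ y⟩ : TangentBundle (𝓡 n) M)) x

variable (e : Trivialization (EuclideanSpace ℝ (Fin n))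
    (TotalSpace.proj : TangentBundle (𝓡 n) M → M)) [MemTrivializationAtlas e]

lemma fieldSmoothAt_symm_const {x : M} (hx : x ∈ e.baseSet) (c : EuclideanSpace ℝ (Fin n)) :
    FieldSmoothAt (fun y : M => (e.symm y c : TangentSpace (𝓡 n) y)) x := by
  refine (e.contMDiffAt_section_iff hx).2 ?_
  refine (contMDiffAt_const (c := c)).congr_of_eventuallyEq ?_
  filter_upwards [e.open_baseSet.mem_nhds hx] with y hy
  simp [e.apply_mk_symm hy]

lemma fieldDifferentiableAt_symm_const {x : M} (hx : x ∈ e.baseSet)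
    (c : EuclideanSpace ℝ (Fin n)) :
    FieldDifferentiableAt (fun y : M => (e.symm y c : TangentSpace (𝓡 n) y)) x :=
  (fieldSmoothAt_symm_const e hx c).mdifferentiableAt (by simp)

/-- The flat connection of `e`, differentiating components, is the reference from which `cov`
differs by a tensor. -/
lemma isCovariantDerivativeOn_trivialization :
    IsCovariantDerivativeOn (I := 𝓡 n) (EuclideanSpace ℝ (Fin n))
      (V := (TangentSpace (𝓡 n) : M → Type _))
      (fun σ x => (e.symmL ℝ x).comp (mvfderiv (𝓡 n) (fun y => (e ⟨y, σ y⟩).2) x)) e.baseSet where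
  add {σ σ' x} hσ hσ' hx := by
    have h1 := (e.mdifferentiableAt_section_iff (𝓡 n) σ hx).1 hσ
    have h2 := (e.mdifferentiableAt_section_iff (𝓡 n) σ' hx).1 hσ'
    have h3 : (fun y => (e ⟨y, (σ + σ') y⟩).2) =ᶠ[𝓝 x]
        ((fun y => (e ⟨y, σ y⟩).2) + fun y => (e ⟨y, σ' y⟩).2) := by
      filter_upwards [e.open_baseSet.mem_nhds hx] with y hy
      simpa using (e.linear ℝ hy).map_add (σ y) (σ' y)
    have h4 : mvfderiv (𝓡 n) (fun y => (e ⟨y, (σ + σ') y⟩).2) x =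
        mvfderiv (𝓡 n) ((fun y => (e ⟨y, σ y⟩).2) + fun y => (e ⟨y, σ' y⟩).2) x := by
      simp only [mvfderiv, h3.mfderiv_eq]
      rfl
    rw [h4, mvfderiv_add h1 h2, ContinuousLinearMap.comp_add]
  leibniz {σ g x} hσ hg hx := by
    have h1 := (e.mdifferentiableAt_section_iff (𝓡 n) σ hx).1 hσ
    have h3 : (fun y => (e ⟨y, (g • σ) y⟩).2) =ᶠ[𝓝 x] (g • fun y => (e ⟨y, σ y⟩).2) := by
      filter_upwards [e.open_baseSet.mem_nhds hx] with y hy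
      simpa using (e.linear ℝ hy).map_smul (g y) (σ y)
    have h4 : mvfderiv (𝓡 n) (fun y => (e ⟨y, (g • σ) y⟩).2) x =
        mvfderiv (𝓡 n) (g • fun y => (e ⟨y, σ y⟩).2) x := by
      simp only [mvfderiv, h3.mfderiv_eq]
      rfl
    rw [h4, mvfderiv_smul hg h1]
    ext X
    have h5 := (e.symmL ℝ x).map_smul (mvfderiv (𝓡 n) g x X) (e ⟨x, σ x⟩).2
    rw [e.symmL_apply hx, e.symmL_apply hx, e.symm_apply_apply_mk hx] at h5
    simp [e.symmL_apply, hx, h5]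

omit [MemTrivializationAtlas e] in
lemma mvfderiv_symm_const {x : M} (hx : x ∈ e.baseSet) (c : EuclideanSpace ℝ (Fin n)) :
    mvfderiv (𝓡 n) (fun y => (e ⟨y, e.symm y c⟩).2) x = 0 := by
  have : (fun y => (e ⟨y, e.symm y c⟩).2) =ᶠ[𝓝 x] fun _ => c := by
    filter_upwards [e.open_baseSet.mem_nhds hx] with y hy
    simp [e.apply_mk_symm hy]
  have h : mvfderiv (𝓡 n) (fun y => (e ⟨y, e.symm y c⟩).2) x =
      mvfderiv (𝓡 n) (fun _ : M => c) x := by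
    simp only [mvfderiv, this.mfderiv_eq]
    rfl
  rw [h, mvfderiv_const]

/-- The difference from the flat connection is tensorial, so it agrees on `σ` and on the field of
constant components through `σ x`. The flat derivative of the latter vanishes. -/
lemma cov_apply_eq (cov : LinearConnection n M) {x : M} (hx : x ∈ e.baseSet)
    {σ : Π x : M, TangentSpace (𝓡 n) x} (hσ : FieldDifferentiableAt σ x)
    (X : TangentSpace (𝓡 n) x) :
    cov σ x X = e.symm x (mvfderiv (𝓡 n) (fun y => (e ⟨y, σ y⟩).2) x X) +
      cov (fun y => e.symm y (e ⟨x, σ x⟩).2) x X := by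
  have hc := cov.isCovariantDerivativeOn (s := e.baseSet)
  have hf := isCovariantDerivativeOn_trivialization e
  have h1 := IsCovariantDerivativeOn.difference_apply hc hf hx hσ
  have h2 := IsCovariantDerivativeOn.difference_apply hc hf hx
    (fieldDifferentiableAt_symm_const e hx (e ⟨x, σ x⟩).2)
  rw [e.symm_apply_apply_mk hx, h1, mvfderiv_symm_const e hx] at h2
  have h4 := congrArg (fun L => L X) h2
  simp [e.symmL_apply, hx] at h4
  rw [← h4]
  abel

/-- The Christoffel symbols of the connection `cov` in the trivialization `e`, see
`christoffel_apply`. -/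
noncomputable def christoffel (cov : LinearConnection n M) (x : M) :
    EuclideanSpace ℝ (Fin n) →L[ℝ] EuclideanSpace ℝ (Fin n) →L[ℝ] EuclideanSpace ℝ (Fin n) :=
  LinearMap.toContinuousLinearMap (LinearMap.toContinuousLinearMap.toLinearMap.comp
    (LinearMap.mk₂ ℝ (fun c v => e.continuousLinearMapAt ℝ x
      (IsCovariantDerivativeOn.difference (cov.isCovariantDerivativeOn (s := e.baseSet))
        (isCovariantDerivativeOn_trivialization e) x (e.symmL ℝ x c) (e.symmL ℝ x v)))
      (by simp) (by simp) (by simp) (by simp)))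

lemma christoffel_apply (cov : LinearConnection n M) {x : M} (hx : x ∈ e.baseSet)
    (c v : EuclideanSpace ℝ (Fin n)) :
    christoffel e cov x c v =
      (e ⟨x, cov (fun y => e.symm y c) x (e.symm x v : TangentSpace (𝓡 n) x)⟩).2 := by
  have h1 := IsCovariantDerivativeOn.difference_apply
    (cov.isCovariantDerivativeOn (s := e.baseSet)) (isCovariantDerivativeOn_trivialization e) hx
    (fieldDifferentiableAt_symm_const e hx c)
  rw [mvfderiv_symm_const e hx, ContinuousLinearMap.comp_zero, sub_zero] at h1
  simp only [christoffel, LinearMap.coe_toContinuousLinearMap', LinearMap.comp_apply,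
    LinearEquiv.coe_coe, LinearMap.mk₂_apply, e.symmL_apply hx, h1]
  rw [Trivialization.continuousLinearMapAt_apply (R := ℝ), e.coe_linearMapAt_of_mem hx]

end Trivialization

/-! ### The covariant derivative along a curve does not depend on the trivialization. -/

section Curves

open Filter Topology

variable {n : ℕ} {M : Type*} [TopologicalSpace M] [ChartedSpace (EuclideanSpace ℝ (Fin n)) M]
  [IsManifold (𝓡 n) ∞ M]

omit [IsManifold (𝓡 n) ∞ M] in
lemma hasDerivWithinAt_comp_curve {G : Type*} [NormedAddCommGroup G] [NormedSpace ℝ G]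
    {γ : ℝ → M} {s : Set ℝ} {t : ℝ} {f : M → G}
    (hf : MDifferentiableAt (𝓡 n) 𝓘(ℝ, G) f (γ t))
    (hγ : MDifferentiableWithinAt 𝓘(ℝ, ℝ) (𝓡 n) γ s t) :
    HasDerivWithinAt (fun r => f (γ r)) (mvfderiv (𝓡 n) f (γ t) (velocity γ s t)) s t := by
  have h := hf.hasMFDerivAt.comp_hasMFDerivWithinAt t hγ.hasMFDerivWithinAt
  have h2 : HasFDerivWithinAt (fun r => f (γ r))
      ((mvfderiv (𝓡 n) f (γ t)).comp (mfderivWithin 𝓘(ℝ, ℝ) (𝓡 n) γ s t) : ℝ →L[ℝ] G) s t :=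
    hasMFDerivWithinAt_iff_hasFDerivWithinAt.1 h
  exact h2.hasDerivWithinAt

variable (e : Trivialization (EuclideanSpace ℝ (Fin n))
    (TotalSpace.proj : TangentBundle (𝓡 n) M → M)) [MemTrivializationAtlas e]

lemma differentiableWithinAt_trivialization {γ : ℝ → M} {s : Set ℝ} {t : ℝ}
    {V : (t : ℝ) → TangentSpace (𝓡 n) (γ t)}
    (hV : MDifferentiableWithinAt 𝓘(ℝ, ℝ) (𝓡 n).tangent
      (fun t => (⟨γ t, V t⟩ : TangentBundle (𝓡 n) M)) s t) (hx : γ t ∈ e.baseSet) :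
    DifferentiableWithinAt ℝ (fun r => (e ⟨γ r, V r⟩).2) s t := by
  have := ((e.mdifferentiableWithinAt_totalSpace_iff (𝓡 n) _
    (by simpa [e.mem_source] using hx)).1 hV).2
  exact this.differentiableWithinAt

lemma mdifferentiableWithinAt_base {γ : ℝ → M} {s : Set ℝ} {t : ℝ}
    {V : (t : ℝ) → TangentSpace (𝓡 n) (γ t)}
    (hV : MDifferentiableWithinAt 𝓘(ℝ, ℝ) (𝓡 n).tangent
      (fun t => (⟨γ t, V t⟩ : TangentBundle (𝓡 n) M)) s t) :
    MDifferentiableWithinAt 𝓘(ℝ, ℝ) (𝓡 n) γ s t :=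
  ((mdifferentiableWithinAt_totalSpace (IB := 𝓡 n) _).1 hV).1

lemma coordChangeL_snd (e' : Trivialization (EuclideanSpace ℝ (Fin n))
    (TotalSpace.proj : TangentBundle (𝓡 n) M → M)) [MemTrivializationAtlas e'] {x : M}
    (hx : x ∈ e.baseSet ∩ e'.baseSet) (v : TangentSpace (𝓡 n) x) :
    e.coordChangeL ℝ e' x (e ⟨x, v⟩).2 = (e' ⟨x, v⟩).2 := by
  rw [e.coordChangeL_apply e' hx, e.symm_apply_apply_mk hx.1]

lemma symm_coordChangeL (e' : Trivialization (EuclideanSpace ℝ (Fin n))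
    (TotalSpace.proj : TangentBundle (𝓡 n) M → M)) [MemTrivializationAtlas e'] {x : M}
    (hx : x ∈ e.baseSet ∩ e'.baseSet) (c : EuclideanSpace ℝ (Fin n)) :
    (e'.symm x (e.coordChangeL ℝ e' x c) : TangentSpace (𝓡 n) x) = e.symm x c := by
  rw [e.coordChangeL_apply e' hx, e'.symm_apply_apply_mk hx.2]

/-- The covariant derivative of a vector field along a curve can be computed in any
trivialization. -/
lemma covDerivAlong_eq (cov : LinearConnection n M) {γ : ℝ → M} {s : Set ℝ} {t : ℝ} (hts : t ∈ s)
    (hs : UniqueDiffWithinAt ℝ s t) {V : (t : ℝ) → TangentSpace (𝓡 n) (γ t)}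
    (hV : MDifferentiableWithinAt 𝓘(ℝ, ℝ) (𝓡 n).tangent
      (fun t => (⟨γ t, V t⟩ : TangentBundle (𝓡 n) M)) s t) (hx : γ t ∈ e.baseSet) :
    covDerivAlong cov γ V s t =
      e.symm (γ t) (derivWithin (fun r => (e ⟨γ r, V r⟩).2) s t) +
        cov (fun x => e.symm x (e ⟨γ t, V t⟩).2) (γ t) (velocity γ s t) := by
  have hγ := mdifferentiableWithinAt_base hV
  set e' := trivializationAt (EuclideanSpace ℝ (Fin n)) (TangentSpace (𝓡 n) : M → Type _) (γ t)
    with he'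
  have hx' : γ t ∈ e'.baseSet := mem_baseSet_trivializationAt _ _ _
  have hd := (differentiableWithinAt_trivialization e hV hx).hasDerivWithinAt
  have hT : MDifferentiableAt (𝓡 n) 𝓘(ℝ, EuclideanSpace ℝ (Fin n) →L[ℝ] EuclideanSpace ℝ (Fin n))
      (fun x : M => (e.coordChangeL ℝ e' x :
        EuclideanSpace ℝ (Fin n) →L[ℝ] EuclideanSpace ℝ (Fin n))) (γ t) :=
    mdifferentiableAt_coordChangeL hx hx'
  have hTd := hasDerivWithinAt_comp_curve hT hγ
  have hprod := hTd.clm_apply hd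
  have hev : ∀ᶠ r in 𝓝[s] t, γ r ∈ e.baseSet ∩ e'.baseSet :=
    hγ.continuousWithinAt.preimage_mem_nhdsWithin
      ((e.open_baseSet.inter e'.open_baseSet).mem_nhds ⟨hx, hx'⟩)
  have hcomp := (hprod.congr_of_eventuallyEq_of_mem (f₁ := fun r => (e' ⟨γ r, V r⟩).2)
    (by filter_upwards [hev] with r hr using (coordChangeL_snd e e' hr (V r)).symm) hts).derivWithin
    hs
  -- Let `T` be the change of trivialization and `c` the `e`-components of `V`. The product rule for
  -- `T c` yields an extra term `T' c`. The same term appears here, because the field with constant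
  -- `e`-components has `e'`-components `T c(t)`.
  have hfield := cov_apply_eq e' cov hx' (fieldDifferentiableAt_symm_const e hx (e ⟨γ t, V t⟩).2)
    (velocity γ s t)
  have hsec : MDifferentiableAt (𝓡 n) 𝓘(ℝ, EuclideanSpace ℝ (Fin n))
      (fun x : M => (e' ⟨x, e.symm x (e ⟨γ t, V t⟩).2⟩).2) (γ t) :=
    (e'.mdifferentiableAt_section_iff (𝓡 n) _ hx').1
      (fieldDifferentiableAt_symm_const e hx (e ⟨γ t, V t⟩).2)
  have hsec' := ((hTd.clm_apply
    (hasDerivWithinAt_const t s (e ⟨γ t, V t⟩).2)).congr_of_eventuallyEq_of_mem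
    (f₁ := fun r => (e' ⟨γ r, e.symm (γ r) (e ⟨γ t, V t⟩).2⟩).2) (by
      filter_upwards [hev] with r hr
      rw [ContinuousLinearEquiv.coe_coe, e.coordChangeL_apply e' hr]) hts).derivWithin hs
  rw [(hasDerivWithinAt_comp_curve hsec hγ).derivWithin hs, map_zero, add_zero] at hsec'
  rw [hfield, hsec', e.symm_apply_apply_mk hx]
  change e'.symm (γ t) (derivWithin (fun r => (e' ⟨γ r, V r⟩).2) s t) +
    cov (fun x => e'.symm x (e' ⟨γ t, V t⟩).2) (γ t) (velocity γ s t) = _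
  rw [hcomp, ← e'.symmL_apply (R := ℝ) hx', map_add, e'.symmL_apply hx', e'.symmL_apply hx',
    ContinuousLinearEquiv.coe_coe, symm_coordChangeL e e' ⟨hx, hx'⟩, ← add_assoc]
  congr 1
  exact add_comm _ _

end Curves

/-! ### The differential equation of parallel transport. -/

section ParallelTransport

open Filter Topology

/-- Existence of solutions of a linear differential equation with small coefficients. -/
lemma exists_solution_of_norm_le_half {E : Type*} [NormedAddCommGroup E] [NormedSpace ℝ E]
    [CompleteSpace E] {A : ℝ → E →L[ℝ] E} (hA : ContinuousOn A (Icc 0 1))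
    (hle : ∀ t ∈ Icc (0 : ℝ) 1, ‖A t‖ ≤ 1 / 2) (c : E) :
    ∃ f : ℝ → E, f 0 = c ∧ ∀ t ∈ Icc (0 : ℝ) 1,
      HasDerivWithinAt f (A t (f t)) (Icc 0 1) t := by
  -- On the ball of radius `‖c‖` around `c` one has `‖x‖ ≤ 2‖c‖`, so the speed is at most `‖c‖` and
  -- the solution stays in the ball up to time `1`.
  have h : IsPicardLindelof (fun t x => A t x) (⟨0, by simp⟩ : Icc (0 : ℝ) 1) c ‖c‖₊ 0 ‖c‖₊
      (1 / 2) := by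
    constructor
    · intro t ht
      refine ((A t).lipschitz.weaken ?_).lipschitzOnWith
      rw [← NNReal.coe_le_coe]
      simpa using hle t ht
    · intro x _
      exact hA.clm_apply continuousOn_const
    · intro t ht x hx
      have hx2 : ‖x‖ ≤ 2 * ‖c‖ := by
        have h1 := norm_le_norm_add_norm_sub' x c
        rw [Metric.mem_closedBall, dist_eq_norm, coe_nnnorm] at hx
        linarith
      calc ‖A t x‖ ≤ ‖A t‖ * ‖x‖ := (A t).le_opNorm x
        _ ≤ 1 / 2 * (2 * ‖c‖) := by gcongr; exact hle t ht
        _ = ‖c‖₊ := by simp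
    · simp
  simpa using h.exists_eq_forall_mem_Icc_hasDerivWithinAt₀

variable {n : ℕ} {M : Type*} [TopologicalSpace M] [ChartedSpace (EuclideanSpace ℝ (Fin n)) M]
  [IsManifold (𝓡 n) ∞ M]
  (e : Trivialization (EuclideanSpace ℝ (Fin n))
    (TotalSpace.proj : TangentBundle (𝓡 n) M → M)) [MemTrivializationAtlas e]

/-- Smoothness of `cov` is applied to global smooth fields, so the local field of constant
components is multiplied by a bump function. Locality of `cov` removes the bump function near `x`.
-/
lemma continuousAt_christoffel [T2Space M] (cov : LinearConnection n M)
    (hcov : CovariantDerivative.ContMDiffCovariantDerivative cov ∞) {x : M} (hx : x ∈ e.baseSet) :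
    ContinuousAt (christoffel e cov) x := by
  refine continuousAt_clm_apply.2 fun c => continuousAt_clm_apply.2 fun v => ?_
  obtain ⟨ψ, -, hψ⟩ := (SmoothBumpFunction.nhds_basis_tsupport (I := 𝓡 n) x).mem_iff.1
    (e.open_baseSet.mem_nhds hx)
  have hsm : ContMDiff (𝓡 n) ((𝓡 n).prod 𝓘(ℝ, EuclideanSpace ℝ (Fin n))) (∞ + 1)
      (fun y => (⟨y, ((ψ : M → ℝ) • fun y => e.symm y c) y⟩ : TangentBundle (𝓡 n) M)) :=
    ContMDiffOn.smul_section_of_tsupport ψ.contMDiff.contMDiffOn e.open_baseSet hψ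
      fun y hy => (fieldSmoothAt_symm_const e hy c).contMDiffWithinAt
  have h1 := hcov.contMDiff.contMDiff hsm.contMDiffOn
  have h2 : ContMDiffAt (𝓡 n) ((𝓡 n).prod 𝓘(ℝ, EuclideanSpace ℝ (Fin n))) ∞
      (fun y => (⟨y, cov ((ψ : M → ℝ) • fun y => e.symm y c) y (e.symm y v)⟩ :
        TangentBundle (𝓡 n) M)) x :=
    (h1.contMDiffAt univ_mem).clm_bundle_apply (fieldSmoothAt_symm_const e hx v)
  have h3 := ((e.contMDiffAt_section_iff hx).1 h2).continuousAt
  refine h3.congr ?_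
  filter_upwards [e.open_baseSet.mem_nhds hx, ψ.eventuallyEq_one.eventuallyEq_nhds] with y hy hψy
  rw [christoffel_apply e cov hy]
  congr 4
  refine cov.isCovariantDerivativeOn.congr_of_eventuallyEq (s := univ) ?_
    (fieldDifferentiableAt_symm_const e hy c) univ_mem ?_
  · exact (hsm y).mdifferentiableAt (by simp)
  · filter_upwards [hψy] with z hz
    simp [hz]

/-- A vector field along a curve is parallel if its components solve the equation of parallel
transport. -/
lemma isParallelOn_of_hasDerivWithinAt (cov : LinearConnection n M) {γ : ℝ → M} {a b : ℝ}
    (hab : a < b) (hγ : MDifferentiableOn 𝓘(ℝ, ℝ) (𝓡 n) γ (Icc a b))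
    (hbase : ∀ t ∈ Icc a b, γ t ∈ e.baseSet) {v : EuclideanSpace ℝ (Fin n)}
    (hv : ∀ t ∈ Icc a b, velocity γ (Icc a b) t = e.symm (γ t) v)
    {c : ℝ → EuclideanSpace ℝ (Fin n)}
    (hc : ∀ t ∈ Icc a b,
      HasDerivWithinAt c (-christoffel e cov (γ t) (c t) v) (Icc a b) t) :
    IsParallelOn cov γ (fun t => e.symm (γ t) (c t)) (Icc a b) := by
  have hcomp : EqOn (fun t => (e (⟨γ t, e.symm (γ t) (c t)⟩ : TangentBundle (𝓡 n) M)).2) c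
      (Icc a b) := fun t ht => by simp [e.apply_mk_symm (hbase t ht)]
  have hmd : MDifferentiableOn 𝓘(ℝ, ℝ) (𝓡 n).tangent
      (fun t => (⟨γ t, e.symm (γ t) (c t)⟩ : TangentBundle (𝓡 n) M)) (Icc a b) := by
    intro t ht
    refine (e.mdifferentiableWithinAt_totalSpace_iff (𝓡 n) _
      (by simpa [e.mem_source] using hbase t ht)).2 ⟨hγ t ht, ?_⟩
    exact ((hc t ht).differentiableWithinAt.congr hcomp (hcomp ht)).mdifferentiableWithinAt
  refine ⟨hmd, fun t ht => ?_⟩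
  have hu := uniqueDiffOn_Icc hab t ht
  rw [covDerivAlong_eq e cov ht hu (hmd t ht) (hbase t ht),
    ((hc t ht).congr hcomp (hcomp ht)).derivWithin hu, hv t ht,
    christoffel_apply e cov (hbase t ht),
    e.apply_mk_symm (hbase t ht), ← e.symmL_apply (R := ℝ) (hbase t ht), map_neg,
    e.symmL_apply (hbase t ht), e.symm_apply_apply_mk (hbase t ht), neg_add_cancel]

end ParallelTransport

/-! ### Comparison of charges through opposite vectors. -/

namespace FinsleroidSpace

variable {n : ℕ} {M : Type*} [TopologicalSpace M] [ChartedSpace (EuclideanSpace ℝ (Fin n)) M]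
  [IsManifold (𝓡 n) ∞ M] (S : FinsleroidSpace n M)

lemma abs_charge_lt (x : M) : |S.charge x| < 4 :=
  abs_lt.2 ⟨S.neg_four_lt_charge x, S.charge_lt_four x⟩

lemma inner_self_nonneg (x : M) (v : TangentSpace (𝓡 n) x) : 0 ≤ S.metric.inner x v v := by
  by_cases hv : v = 0
  · simp [hv]
  · exact (S.metric.pos x v hv).le

lemma axis_sq_le (x : M) (v : TangentSpace (𝓡 n) x) :
    S.axis x v ^ 2 ≤ S.metric.inner x v v := by
  obtain ⟨u, hu, hu1⟩ := S.unit_axis x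
  -- The square of this vector is `α² - β²`.
  have h := S.inner_self_nonneg x (v - S.axis x v • u)
  simp only [map_sub, map_smul, sub_apply, smul_apply,
    smul_eq_mul, hu1, S.metric.symm x v u, ← hu v] at h
  linarith

lemma energy_nonneg (x : M) (v : TangentSpace (𝓡 n) x) : 0 ≤ S.energy x v :=
  finsleroidEnergy_nonneg (S.abs_charge_lt x) (S.axis_sq_le x v)

lemma energy_eq_of_norm_eq {x y : M} {v : TangentSpace (𝓡 n) x} {w : TangentSpace (𝓡 n) y}
    (h : S.norm x v = S.norm y w) : S.energy x v = S.energy y w := by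
  have h1 := S.energy_nonneg x v
  have h2 := S.energy_nonneg y w
  have := (Real.sqrt_inj (by linarith) (by linarith)).1 h
  linarith

/-- To be applied with `w` the parallel translate of the axis vector `u`. -/
lemma abs_charge_le_of_norm_eq {x y : M} {u : TangentSpace (𝓡 n) x}
    (hu : ∀ v, S.axis x v = S.metric.inner x u v) (hu1 : S.metric.inner x u u = 1)
    {w : TangentSpace (𝓡 n) y} (h : S.norm y w = S.norm x u)
    (h' : S.norm y (-w) = S.norm x (-u)) : |S.charge x| ≤ |S.charge y| := by
  have h1 := S.energy_eq_of_norm_eq h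
  have h2 := S.energy_eq_of_norm_eq h'
  simp only [energy, map_neg, neg_apply, neg_neg, hu u, hu1] at h1 h2
  exact abs_charge_le_of_finsleroidEnergy_eq (S.abs_charge_lt x) (S.abs_charge_lt y)
    (S.axis_sq_le y w) h1 h2

end FinsleroidSpace

/-! ### Segments in a chart. -/

section ChartLine

open Filter Topology

variable {n : ℕ} {M : Type*} [TopologicalSpace M] [ChartedSpace (EuclideanSpace ℝ (Fin n)) M]
  [IsManifold (𝓡 n) ∞ M]

/-- The curve which runs, in the chart at `x`, along the segment from `p` to `q`. -/
noncomputable def chartLine (x : M) (p q : EuclideanSpace ℝ (Fin n)) (t : ℝ) : M :=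
  (extChartAt (𝓡 n) x).symm (AffineMap.lineMap p q t)

variable {x : M} {p q : EuclideanSpace ℝ (Fin n)}

lemma contMDiffOn_chartLine {s : Set ℝ}
    (h : ∀ t ∈ s, AffineMap.lineMap p q t ∈ (extChartAt (𝓡 n) x).target) :
    ContMDiffOn 𝓘(ℝ, ℝ) (𝓡 n) ∞ (chartLine x p q) s := by
  refine (contMDiffOn_extChartAt_symm x).comp (ContDiff.contMDiff ?_).contMDiffOn h
  change ContDiff ℝ ∞ fun t : ℝ => AffineMap.lineMap p q t
  simp only [AffineMap.lineMap_apply_module']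
  fun_prop

/-- The preferred trivialization at `x` is the derivative of the chart, so the velocity has the
constant components `q - p`. -/
lemma velocity_chartLine {s : Set ℝ}
    (h : ∀ t ∈ s, AffineMap.lineMap p q t ∈ (extChartAt (𝓡 n) x).target) {t : ℝ} (ht : t ∈ s)
    (hs : UniqueDiffWithinAt ℝ s t) :
    velocity (chartLine x p q) s t =
      (trivializationAt (EuclideanSpace ℝ (Fin n)) (TangentSpace (𝓡 n) : M → Type _) x).symm
        (chartLine x p q t) (q - p) := by
  have hd : HasDerivWithinAt (fun t : ℝ => AffineMap.lineMap p q t) (q - p) s t :=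
    AffineMap.hasDerivWithinAt_lineMap
  have hmem : chartLine x p q t ∈ (chartAt (EuclideanSpace ℝ (Fin n)) x).source := by
    rw [← extChartAt_source (𝓡 n)]
    exact (extChartAt (𝓡 n) x).map_target (h t ht)
  have hbase : chartLine x p q t ∈ (trivializationAt (EuclideanSpace ℝ (Fin n))
      (TangentSpace (𝓡 n) : M → Type _) x).baseSet := by
    simpa [TangentBundle.trivializationAt_baseSet] using hmem
  rw [← Trivialization.symmL_apply (R := ℝ) _ hbase, TangentBundle.symmL_trivializationAt hmem]
  have hinv : extChartAt (𝓡 n) x (chartLine x p q t) = AffineMap.lineMap p q t :=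
    (extChartAt (𝓡 n) x).right_inv (h t ht)
  have h1 : MDifferentiableWithinAt 𝓘(ℝ, EuclideanSpace ℝ (Fin n)) (𝓡 n)
      (extChartAt (𝓡 n) x).symm (range (𝓡 n)) (AffineMap.lineMap p q t) :=
    mdifferentiableWithinAt_extChartAt_symm (h t ht)
  have h2 := h1.hasMFDerivWithinAt.comp t hd.hasFDerivWithinAt.hasMFDerivWithinAt
    (fun r _ => by simp)
  have h3 := h2.mfderivWithin hs.uniqueMDiffWithinAt
  rw [hinv]
  have h4 := congrArg (fun L : ℝ →L[ℝ] EuclideanSpace ℝ (Fin n) => L 1) h3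
  refine Eq.trans h4 ?_
  change mfderivWithin 𝓘(ℝ, EuclideanSpace ℝ (Fin n)) (𝓡 n) (extChartAt (𝓡 n) x).symm
    (range (𝓡 n)) (AffineMap.lineMap p q t) (ContinuousLinearMap.toSpanSingleton ℝ (q - p) 1) = _
  rw [ContinuousLinearMap.toSpanSingleton_apply, one_smul]
  rfl

end ChartLine

/-! ### A generalized Berwald Finsleroid space has constant charge. -/

section Necessity

open Filter Topology

variable {n : ℕ} {M : Type*} [TopologicalSpace M] [ChartedSpace (EuclideanSpace ℝ (Fin n)) M]
  [IsManifold (𝓡 n) ∞ M]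

lemma continuous_opNorm (E : Type*) [NormedAddCommGroup E] [NormedSpace ℝ E] :
    Continuous fun A : E →L[ℝ] E →L[ℝ] E => ‖A‖ :=
  continuous_norm (E := E →L[ℝ] E →L[ℝ] E)

lemma FinsleroidSpace.abs_charge_le_of_isCompatible (S : FinsleroidSpace n M)
    {cov : LinearConnection n M} (hS : IsCompatible cov S.norm)
    (e : Trivialization (EuclideanSpace ℝ (Fin n))
      (TotalSpace.proj : TangentBundle (𝓡 n) M → M)) [MemTrivializationAtlas e]
    {γ : ℝ → M} (hγ : ContMDiffOn 𝓘(ℝ, ℝ) (𝓡 n) ∞ γ (Icc 0 1))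
    (hbase : ∀ t ∈ Icc (0 : ℝ) 1, γ t ∈ e.baseSet) {v : EuclideanSpace ℝ (Fin n)}
    (hv : ∀ t ∈ Icc (0 : ℝ) 1, velocity γ (Icc 0 1) t = e.symm (γ t) v)
    (hcont : ∀ t ∈ Icc (0 : ℝ) 1, ContinuousAt (christoffel e cov) (γ t))
    (hle : ∀ t ∈ Icc (0 : ℝ) 1, ‖christoffel e cov (γ t)‖ * ‖v‖ ≤ 1 / 2) :
    |S.charge (γ 0)| ≤ |S.charge (γ 1)| := by
  obtain ⟨u, hu, hu1⟩ := S.unit_axis (γ 0)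
  have h0 : (0 : ℝ) ∈ Icc (0 : ℝ) 1 := by simp
  obtain ⟨c, hc0, hc⟩ := exists_solution_of_norm_le_half
    (A := fun t => -(christoffel e cov (γ t)).flip v) (c := (e ⟨γ 0, u⟩).2)
    (by
      refine ContinuousOn.neg (continuousOn_clm_apply.2 fun w => ?_)
      have h1 : ContinuousOn (fun t => christoffel e cov (γ t)) (Icc 0 1) := fun t ht =>
        (hcont t ht).comp_continuousWithinAt (hγ.continuousOn t ht)
      exact (h1.clm_apply continuousOn_const).clm_apply continuousOn_const)
    (fun t ht => by
      rw [norm_neg]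
      refine ((christoffel e cov (γ t)).flip.le_opNorm v).trans ?_
      rw [ContinuousLinearMap.opNorm_flip]
      exact hle t ht)
  have hmd : MDifferentiableOn 𝓘(ℝ, ℝ) (𝓡 n) γ (Icc 0 1) := hγ.mdifferentiableOn (by simp)
  have hpar := isParallelOn_of_hasDerivWithinAt e cov one_pos hmd hbase hv
    (c := c) (fun t ht => by simpa using hc t ht)
  -- By linearity of the equation `-c` is also a solution, which transports `-u`.
  have hpar' := isParallelOn_of_hasDerivWithinAt e cov one_pos hmd hbase hv
    (c := -c) (fun t ht => by simpa using (hc t ht).neg)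
  have hneg (t : ℝ) (ht : t ∈ Icc (0 : ℝ) 1) :
      (e.symm (γ t) ((-c) t) : TangentSpace (𝓡 n) (γ t)) = -e.symm (γ t) (c t) := by
    rw [← e.symmL_apply (R := ℝ) (hbase t ht), Pi.neg_apply, map_neg, e.symmL_apply (hbase t ht)]
  have hu0 : (e.symm (γ 0) (c 0) : TangentSpace (𝓡 n) (γ 0)) = u := by
    rw [hc0, e.symm_apply_apply_mk (hbase 0 h0)]
  refine S.abs_charge_le_of_norm_eq hu hu1 (w := e.symm (γ 1) (c 1)) ?_ ?_
  · exact hS γ 0 1 one_pos hγ _ _ ⟨_, hpar, hu0, rfl⟩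
  · exact hS γ 0 1 one_pos hγ _ _ ⟨_, hpar', by rw [hneg 0 h0, hu0], hneg 1 (by simp)⟩

/-- The absolute value of the charge of a generalized Berwald Finsleroid-Finsler space is locally
constant. -/
lemma FinsleroidSpace.eventually_abs_charge_eq [T2Space M] (S : FinsleroidSpace n M)
    (hS : IsGeneralizedBerwald S.norm) (x : M) :
    ∀ᶠ y in 𝓝 x, |S.charge y| = |S.charge x| := by
  obtain ⟨cov, hcov, hcomp⟩ := hS
  set e := trivializationAt (EuclideanSpace ℝ (Fin n)) (TangentSpace (𝓡 n) : M → Type _) x with he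
  have hbase_eq : e.baseSet = (extChartAt (𝓡 n) x).source := by
    simp [he, TangentBundle.trivializationAt_baseSet]
  have hx : x ∈ e.baseSet := mem_baseSet_trivializationAt _ _ _
  set C := ‖christoffel e cov x‖ + 1 with hC
  have hCpos : 0 < C := by positivity
  have hev : ∀ᶠ p in 𝓝 (extChartAt (𝓡 n) x x), p ∈ (extChartAt (𝓡 n) x).target ∧
      ‖christoffel e cov ((extChartAt (𝓡 n) x).symm p)‖ < C := by
    refine Filter.Eventually.and (extChartAt_target_mem_nhds x) ?_
    have h0 : ContinuousAt (christoffel e cov)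
        ((extChartAt (𝓡 n) x).symm (extChartAt (𝓡 n) x x)) := by
      rw [extChartAt_to_inv]
      exact continuousAt_christoffel e cov hcov hx
    have h1 := (continuous_opNorm _).continuousAt.comp (h0.comp (continuousAt_extChartAt_symm x))
    refine h1.eventually_lt continuousAt_const ?_
    change ‖christoffel e cov ((extChartAt (𝓡 n) x).symm (extChartAt (𝓡 n) x x))‖ < C
    rw [extChartAt_to_inv, hC]
    exact lt_add_one _
  obtain ⟨r, hr, hball⟩ := Metric.eventually_nhds_iff_ball.1 hev
  -- Points of the ball then satisfy `‖q - p‖ ≤ 1 / (2C)`, so `‖Γ‖ ‖q - p‖ ≤ 1 / 2` along the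
  -- segment, as the existence of transport up to time `1` requires.
  set ρ := min r (1 / (4 * C)) with hρ
  have hρpos : 0 < ρ := by positivity
  have key : ∀ p ∈ Metric.ball (extChartAt (𝓡 n) x x) ρ,
      ∀ q ∈ Metric.ball (extChartAt (𝓡 n) x x) ρ,
      |S.charge ((extChartAt (𝓡 n) x).symm p)| ≤ |S.charge ((extChartAt (𝓡 n) x).symm q)| := by
    intro p hp q hq
    have hline : ∀ t ∈ Icc (0 : ℝ) 1,
        AffineMap.lineMap p q t ∈ Metric.ball (extChartAt (𝓡 n) x x) r := fun t ht =>
      Metric.ball_subset_ball (min_le_left _ _)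
        ((convex_ball _ _).lineMap_mem hp hq ht)
    have htar : ∀ t ∈ Icc (0 : ℝ) 1,
        AffineMap.lineMap p q t ∈ (extChartAt (𝓡 n) x).target := fun t ht =>
      (hball _ (hline t ht)).1
    have hb : ∀ t ∈ Icc (0 : ℝ) 1, chartLine x p q t ∈ e.baseSet := fun t ht => by
      rw [hbase_eq]
      exact (extChartAt (𝓡 n) x).map_target (htar t ht)
    have hdist : ‖q - p‖ ≤ 1 / (2 * C) := by
      rw [← dist_eq_norm]
      have h1 := dist_triangle_right q p (extChartAt (𝓡 n) x x)
      have h2 : dist q (extChartAt (𝓡 n) x x) < 1 / (4 * C) :=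
        (Metric.mem_ball.1 hq).trans_le (min_le_right _ _)
      have h3 : dist p (extChartAt (𝓡 n) x x) < 1 / (4 * C) :=
        (Metric.mem_ball.1 hp).trans_le (min_le_right _ _)
      have h4 : 1 / (2 * C) = 1 / (4 * C) + 1 / (4 * C) := by field_simp; norm_num
      linarith
    have := S.abs_charge_le_of_isCompatible hcomp e (γ := chartLine x p q) (v := q - p)
      (contMDiffOn_chartLine htar) hb
      (fun t ht => velocity_chartLine htar ht (uniqueDiffOn_Icc one_pos t ht))
      (fun t ht => continuousAt_christoffel e cov hcov (hb t ht))
      (fun t ht => by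
        calc _ ≤ C * (1 / (2 * C)) := by
              gcongr
              exact (hball _ (hline t ht)).2.le
          _ = 1 / 2 := by field_simp)
    simpa [chartLine] using this
  filter_upwards [(continuousAt_extChartAt (I := 𝓡 n) x).preimage_mem_nhds
    (Metric.ball_mem_nhds _ hρpos), extChartAt_source_mem_nhds (I := 𝓡 n) x] with y hy hys
  have hx0 := Metric.mem_ball_self (x := extChartAt (𝓡 n) x x) hρpos
  have h1 := key _ hy _ hx0
  have h2 := key _ hx0 _ hy
  rw [(extChartAt (𝓡 n) x).left_inv hys, extChartAt_to_inv] at h1 h2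
  exact le_antisymm h1 h2

theorem FinsleroidSpace.exists_charge_eq [T2Space M] [ConnectedSpace M] (S : FinsleroidSpace n M)
    (hS : IsGeneralizedBerwald S.norm) : ∃ c : ℝ, ∀ x, S.charge x = c := by
  have hloc : IsLocallyConstant fun x => |S.charge x| :=
    IsLocallyConstant.iff_eventually_eq _ |>.2 fun x => S.eventually_abs_charge_eq hS x
  obtain ⟨x₀⟩ := (inferInstance : Nonempty M)
  refine ⟨S.charge x₀, fun x => ?_⟩
  -- A continuous map from a connected space to a finite, hence discrete, set of reals is constant;
  -- this rules out a change of sign.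
  have hmaps : MapsTo S.charge univ {|S.charge x₀|, -|S.charge x₀|} := fun y _ =>
    eq_or_eq_neg_of_abs_eq (hloc.apply_eq_of_preconnectedSpace y x₀)
  have hfin : ({|S.charge x₀|, -|S.charge x₀|} : Set ℝ).Finite := by simp
  exact isPreconnected_univ.constant_of_mapsTo hfin.isDiscrete
    S.contMDiff_charge.continuous.continuousOn hmaps (mem_univ x) (mem_univ x₀)

end Necessity

/-! ### Smooth local orthonormal frames. -/

section OrthonormalFrame

open Filter Topology InnerProductSpace

variable {n : ℕ} {M : Type*} [TopologicalSpace M] [ChartedSpace (EuclideanSpace ℝ (Fin n)) M]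
  [IsManifold (𝓡 n) ∞ M]

section

variable {x : M} {σ τ : (x : M) → TangentSpace (𝓡 n) x}

lemma contMDiffAt_metric (g : ContMDiffRiemannianMetric (𝓡 n) ∞ (EuclideanSpace ℝ (Fin n))
      (TangentSpace (𝓡 n) : M → Type _)) (hσ : FieldSmoothAt σ x) (hτ : FieldSmoothAt τ x) :
    ContMDiffAt (𝓡 n) 𝓘(ℝ, ℝ) ∞ (fun y => g.inner y (σ y) (τ y)) x := by
  let _ : RiemannianBundle (TangentSpace (𝓡 n) : M → Type _) := ⟨g.toRiemannianMetric⟩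
  exact ContMDiffAt.inner_bundle (IB := 𝓡 n) (F := EuclideanSpace ℝ (Fin n))
    (E := (TangentSpace (𝓡 n) : M → Type _)) hσ hτ

lemma mdifferentiableAt_metric (g : ContMDiffRiemannianMetric (𝓡 n) ∞ (EuclideanSpace ℝ (Fin n))
      (TangentSpace (𝓡 n) : M → Type _)) (hσ : FieldDifferentiableAt σ x)
    (hτ : FieldDifferentiableAt τ x) :
    MDifferentiableAt (𝓡 n) 𝓘(ℝ, ℝ) (fun y => g.inner y (σ y) (τ y)) x := by
  let _ : RiemannianBundle (TangentSpace (𝓡 n) : M → Type _) := ⟨g.toRiemannianMetric⟩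
  exact MDifferentiableAt.inner_bundle (IB := 𝓡 n) (F := EuclideanSpace ℝ (Fin n))
    (E := (TangentSpace (𝓡 n) : M → Type _)) hσ hτ

lemma contMDiffAt_axis (S : FinsleroidSpace n M) (hσ : FieldSmoothAt σ x) :
    ContMDiffAt (𝓡 n) 𝓘(ℝ, ℝ) ∞ (fun y => S.axis y (σ y)) x := by
  have h := (S.contMDiff_axis x).clm_bundle_apply hσ
  exact (contMDiffAt_totalSpace.1 h).2

lemma mdifferentiableAt_axis (S : FinsleroidSpace n M) (hσ : FieldDifferentiableAt σ x) :
    MDifferentiableAt (𝓡 n) 𝓘(ℝ, ℝ) (fun y => S.axis y (σ y)) x := by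
  have h := ((S.contMDiff_axis x).mdifferentiableAt (by simp)).clm_bundle_apply hσ
  exact ((mdifferentiableAt_totalSpace (IB := 𝓡 n) _).1 h).2

end

lemma exists_orthonormal_frame (g : ContMDiffRiemannianMetric (𝓡 n) ∞ (EuclideanSpace ℝ (Fin n))
    (TangentSpace (𝓡 n) : M → Type _)) (x₀ : M) :
    ∃ U : Set M, IsOpen U ∧ x₀ ∈ U ∧ ∃ f : Fin n → (x : M) → TangentSpace (𝓡 n) x,
      (∀ j, ∀ x ∈ U, FieldSmoothAt (f j) x) ∧
      ∀ x ∈ U, ∀ v, ∑ j, g.inner x v (f j x) • f j x = v := by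
  let _ : RiemannianBundle (TangentSpace (𝓡 n) : M → Type _) := ⟨g.toRiemannianMetric⟩
  set e := trivializationAt (EuclideanSpace ℝ (Fin n)) (TangentSpace (𝓡 n) : M → Type _) x₀
  let b := (EuclideanSpace.basisFun (Fin n) ℝ).toBasis
  let h : Fin n → (x : M) → TangentSpace (𝓡 n) x := fun j x => e.symm x (b j)
  have hli : ∀ x ∈ e.baseSet, LinearIndependent ℝ (h · x) := fun x hx => by
    have h1 : (h · x) = e.basisAt b hx := by
      funext j
      simp [h, Trivialization.basisAt]
    rw [h1]
    exact (e.basisAt b hx).linearIndependent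
  let G : Fin n → (x : M) → TangentSpace (𝓡 n) x := fun j x => gramSchmidt ℝ (h · x) j
  have hne : ∀ x ∈ e.baseSet, ∀ j, G j x ≠ 0 := fun x hx j => gramSchmidt_ne_zero j (hli x hx)
  have hinner : ∀ (x : M) (v w : TangentSpace (𝓡 n) x), inner ℝ v w = g.inner x v w :=
    fun _ _ _ => rfl
  -- Each Gram-Schmidt step subtracts projections on earlier fields, which are smooth by induction
  -- and have nonvanishing square norms.
  have hG : ∀ x ∈ e.baseSet, ∀ j, FieldSmoothAt (G j) x := by
    intro x hx j
    induction j using WellFoundedLT.induction with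
    | ind j ih =>
      have h1 : FieldSmoothAt (h j) x := fieldSmoothAt_symm_const e hx (b j)
      have h2 : FieldSmoothAt (fun y => h j y - ∑ i ∈ Finset.Iio j,
          (g.inner y (G i y) (h j y) / g.inner y (G i y) (G i y)) • G i y) x := by
        refine h1.sub_section (ContMDiffAt.sum_section fun i hi => ?_)
        have hi' := ih i (Finset.mem_Iio.1 hi)
        refine ContMDiffAt.smul_section ?_ hi'
        exact (contMDiffAt_metric g hi' h1).div₀ (contMDiffAt_metric g hi' hi')
          (g.pos x _ (hne x hx i)).ne'
      convert h2 using 3 with y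
      simp only [G]
      rw [gramSchmidt_def]
      simp only [Submodule.starProjection_singleton, ← real_inner_self_eq_norm_sq, hinner]
      rfl
  refine ⟨e.baseSet, e.open_baseSet, mem_baseSet_trivializationAt _ _ _,
    fun j x => gramSchmidtNormed ℝ (h · x) j, fun j x hx => ?_, fun x hx v => ?_⟩
  · have h2 : FieldSmoothAt (fun y => (√(g.inner y (G j y) (G j y)))⁻¹ • G j y) x := by
      have hpos := g.pos x _ (hne x hx j)
      refine ContMDiffAt.smul_section (ContMDiffAt.inv₀ ?_ (Real.sqrt_pos.2 hpos).ne') (hG x hx j)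
      exact ContDiffAt.comp_contMDiffAt (f := fun y => g.inner y (G j y) (G j y))
        (Real.contDiffAt_sqrt hpos.ne') (contMDiffAt_metric g (hG x hx j) (hG x hx j))
    convert h2 using 3 with y
    simp only [gramSchmidtNormed, norm_eq_sqrt_real_inner, hinner]
    rfl
  · have hfin : Module.finrank ℝ (TangentSpace (𝓡 n) x) = Fintype.card (Fin n) := by
      rw [Module.finrank_eq_card_basis (e.basisAt b hx)]
    have : FiniteDimensional ℝ (TangentSpace (𝓡 n) x) :=
      (e.basisAt b hx).finiteDimensional_of_finite
    have ho := gramSchmidtNormed_orthonormal (hli x hx)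
    have := (gramSchmidtOrthonormalBasis hfin (h · x)).sum_repr' v
    conv_rhs => rw [← this]
    refine Finset.sum_congr rfl fun j _ => ?_
    rw [gramSchmidtOrthonormalBasis_apply hfin (ho.ne_zero j), real_inner_comm]
    rfl

end OrthonormalFrame

/-! ### Local connections preserving the metric and the axis one-form. -/

section FrameConnection

open Filter Topology

variable {n : ℕ} {M : Type*} [TopologicalSpace M] [ChartedSpace (EuclideanSpace ℝ (Fin n)) M]
  [IsManifold (𝓡 n) ∞ M]

/-- The family `a` of vector fields on the open set `U` consists of the unit vector field dual to
the axis one-form and of a Parseval frame of the kernel of the axis one-form. -/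
structure IsAdaptedFrameOn (S : FinsleroidSpace n M) {ι : Type*} [Fintype ι]
    (a : Option ι → (x : M) → TangentSpace (𝓡 n) x) (U : Set M) : Prop where
  isOpen : IsOpen U
  smooth : ∀ k, ∀ x ∈ U, FieldSmoothAt (a k) x
  sum_inner_smul : ∀ x ∈ U, ∀ v, ∑ k, S.metric.inner x v (a k x) • a k x = v
  inner_none : ∀ x ∈ U, ∀ v, S.metric.inner x v (a none x) = S.axis x v
  axis_none : ∀ x ∈ U, S.axis x (a none x) = 1
  axis_some : ∀ x ∈ U, ∀ j, S.axis x (a (some j) x) = 0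

lemma exists_isAdaptedFrameOn (S : FinsleroidSpace n M) (x₀ : M) :
    ∃ U : Set M, x₀ ∈ U ∧ ∃ a : Option (Fin n) → (x : M) → TangentSpace (𝓡 n) x,
      IsAdaptedFrameOn S a U := by
  obtain ⟨U, hU, hx₀, f, hf, hsum⟩ := exists_orthonormal_frame S.metric x₀
  let u : (x : M) → TangentSpace (𝓡 n) x := fun x => ∑ j, S.axis x (f j x) • f j x
  have hu : ∀ x ∈ U, ∀ v, S.metric.inner x v (u x) = S.axis x v := by
    intro x hx v
    obtain ⟨w, hw, -⟩ := S.unit_axis x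
    have h1 : u x = w := by
      rw [← hsum x hx w]
      exact Finset.sum_congr rfl fun j _ => by rw [hw]
    rw [h1, hw, S.metric.symm]
  have hu1 : ∀ x ∈ U, S.axis x (u x) = 1 := by
    intro x hx
    obtain ⟨w, hw, hw1⟩ := S.unit_axis x
    have h1 : u x = w := by
      rw [← hsum x hx w]
      exact Finset.sum_congr rfl fun j _ => by rw [hw]
    rw [h1, hw, hw1]
  have hus : ∀ x ∈ U, FieldSmoothAt u x := fun x hx =>
    ContMDiffAt.sum_section fun j _ =>
      ContMDiffAt.smul_section (contMDiffAt_axis S (hf j x hx)) (hf j x hx)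
  -- The projections of an orthonormal frame to `ker β` are linearly dependent, but still form a
  -- Parseval frame of `ker β`. This avoids choosing a smooth basis of `ker β`.
  let p : Fin n → (x : M) → TangentSpace (𝓡 n) x := fun j x => f j x - S.axis x (f j x) • u x
  refine ⟨U, hx₀, fun k => k.elim u p, hU, ?_, ?_, hu, hu1, ?_⟩
  · rintro (_ | j) x hx
    · exact hus x hx
    · exact (hf j x hx).sub_section
        (ContMDiffAt.smul_section (contMDiffAt_axis S (hf j x hx)) (hus x hx))
  · intro x hx v
    have h1 : ∑ j, S.metric.inner x v (f j x) * S.axis x (f j x) = S.axis x v := by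
      conv_rhs => rw [← hsum x hx v]
      simp
    have h2 : ∑ j, S.axis x (f j x) * S.axis x (f j x) = 1 := by
      conv_rhs => rw [← hu1 x hx]
      simp [u]
    -- Summed over `j`, the four terms give `v - β(v)u - β(v)u + β(v)u`, and the term of `u` in the
    -- frame restores `β(v)u`.
    have h3 (j : Fin n) : S.metric.inner x v (p j x) • p j x =
        S.metric.inner x v (f j x) • f j x
          - (S.metric.inner x v (f j x) * S.axis x (f j x)) • u x
          - S.axis x v • S.axis x (f j x) • f j x
          + S.axis x v • (S.axis x (f j x) * S.axis x (f j x)) • u x := by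
      simp only [p, map_sub, map_smul, hu x hx, smul_eq_mul]
      module
    rw [Fintype.sum_option]
    simp only [Option.elim]
    rw [Finset.sum_congr rfl fun j _ => h3 j, Finset.sum_add_distrib, Finset.sum_sub_distrib,
      Finset.sum_sub_distrib, hsum x hx, ← Finset.sum_smul, h1, ← Finset.smul_sum,
      ← Finset.smul_sum, ← Finset.sum_smul, h2, hu x hx]
    change _ + (_ - _ - S.axis x v • u x + _) = _
    module
  · intro x hx j
    simp [p, hu1 x hx]

/-- The connection for which the fields of the Parseval frame `a` have "constant components". -/
noncomputable def frameCov (S : FinsleroidSpace n M) {ι : Type*} [Fintype ι]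
    (a : ι → (x : M) → TangentSpace (𝓡 n) x) (σ : (x : M) → TangentSpace (𝓡 n) x) (x : M) :
    TangentSpace (𝓡 n) x →L[ℝ] TangentSpace (𝓡 n) x :=
  ∑ k, (mvfderiv (𝓡 n) (fun y => S.metric.inner y (σ y) (a k y)) x).smulRight (a k x)

omit [IsManifold (𝓡 n) ∞ M] in
lemma mvfderiv_congr {G : Type*} [NormedAddCommGroup G] [NormedSpace ℝ G] {f f' : M → G} {x : M}
    (h : f =ᶠ[𝓝 x] f') : mvfderiv (𝓡 n) f x = mvfderiv (𝓡 n) f' x := by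
  simp only [mvfderiv, h.mfderiv_eq]
  rfl

omit [IsManifold (𝓡 n) ∞ M] in
lemma mvfderiv_finset_sum {ι : Type*} {s : Finset ι} {f : ι → M → ℝ} {x : M}
    (hf : ∀ i ∈ s, MDifferentiableAt (𝓡 n) 𝓘(ℝ, ℝ) (f i) x) :
    MDifferentiableAt (𝓡 n) 𝓘(ℝ, ℝ) (fun y => ∑ i ∈ s, f i y) x ∧
      mvfderiv (𝓡 n) (fun y => ∑ i ∈ s, f i y) x = ∑ i ∈ s, mvfderiv (𝓡 n) (f i) x := by
  classical
  induction s using Finset.induction_on with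
  | empty =>
    simp only [Finset.sum_empty]
    exact ⟨mdifferentiableAt_const, mvfderiv_const (0 : ℝ)⟩
  | insert i s hi ih =>
    simp only [Finset.sum_insert hi]
    obtain ⟨h1, h2⟩ := ih fun j hj => hf j (Finset.mem_insert_of_mem hj)
    have h3 := hf i (Finset.mem_insert_self i s)
    exact ⟨h3.add h1, h2 ▸ mvfderiv_add h3 h1⟩

variable {S : FinsleroidSpace n M} {ι : Type*} [Fintype ι]
    {a : Option ι → (x : M) → TangentSpace (𝓡 n) x} {U : Set M}

namespace IsAdaptedFrameOn

lemma differentiable (ha : IsAdaptedFrameOn S a U) (k : Option ι) {x : M} (hx : x ∈ U) :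
    FieldDifferentiableAt (a k) x :=
  (ha.smooth k x hx).mdifferentiableAt (by simp)

/-- The Leibniz rule needs only the Parseval identity `∑ ⟨σ, aₖ⟩ aₖ = σ`, not linear independence.
-/
lemma isCovariantDerivativeOn (ha : IsAdaptedFrameOn S a U) :
    IsCovariantDerivativeOn (I := 𝓡 n) (EuclideanSpace ℝ (Fin n))
      (V := (TangentSpace (𝓡 n) : M → Type _)) (frameCov S a) U where
  add {σ σ' x} hσ hσ' hx := by
    simp only [frameCov, ← Finset.sum_add_distrib]
    refine Finset.sum_congr rfl fun k _ => ?_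
    have h : (fun y => S.metric.inner y ((σ + σ') y) (a k y)) =
        (fun y => S.metric.inner y (σ y) (a k y)) + fun y => S.metric.inner y (σ' y) (a k y) := by
      ext y
      simp
    rw [h, mvfderiv_add (mdifferentiableAt_metric S.metric hσ (ha.differentiable k hx))
      (mdifferentiableAt_metric S.metric hσ' (ha.differentiable k hx))]
    ext X
    simp [add_smul]
  leibniz {σ f x} hσ hf hx := by
    have h (k : Option ι) : mvfderiv (𝓡 n) (fun y => S.metric.inner y ((f • σ) y) (a k y)) x =
        f x • mvfderiv (𝓡 n) (fun y => S.metric.inner y (σ y) (a k y)) x +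
          S.metric.inner x (σ x) (a k x) • mvfderiv (𝓡 n) f x := by
      have h1 : (fun y => S.metric.inner y ((f • σ) y) (a k y)) =
          f * fun y => S.metric.inner y (σ y) (a k y) := by
        ext y
        simp
      rw [h1, mvfderiv_mul hf (mdifferentiableAt_metric S.metric hσ (ha.differentiable k hx))]
    ext X
    simp only [frameCov, h, sum_apply, ContinuousLinearMap.smulRight_apply,
      add_apply, smul_apply, add_smul, Finset.sum_add_distrib, smul_eq_mul, mul_smul,
      ← Finset.smul_sum]
    congr 1
    simp only [smul_comm _ (mvfderiv (𝓡 n) f x X), ← Finset.smul_sum, ha.sum_inner_smul x hx]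

lemma mvfderiv_axis (ha : IsAdaptedFrameOn S a U) {x : M} (hx : x ∈ U)
    (σ : (x : M) → TangentSpace (𝓡 n) x) (X : TangentSpace (𝓡 n) x) :
    mvfderiv (𝓡 n) (fun y => S.axis y (σ y)) x X = S.axis x (frameCov S a σ x X) := by
  have h : (fun y => S.axis y (σ y)) =ᶠ[𝓝 x] fun y => S.metric.inner y (σ y) (a none y) := by
    filter_upwards [ha.isOpen.mem_nhds hx] with y hy
    rw [ha.inner_none y hy]
  rw [mvfderiv_congr h]
  simp [frameCov, Fintype.sum_option, ha.axis_none x hx, ha.axis_some x hx]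

lemma inner_eq_sum (ha : IsAdaptedFrameOn S a U) {x : M} (hx : x ∈ U)
    (v w : TangentSpace (𝓡 n) x) :
    S.metric.inner x v w = ∑ k, S.metric.inner x v (a k x) * S.metric.inner x w (a k x) := by
  conv_lhs => rw [← ha.sum_inner_smul x hx v]
  simp [S.metric.symm x w]

/-- Product rule for the polarized Parseval identity `⟨σ, τ⟩ = ∑ ⟨σ, aₖ⟩⟨τ, aₖ⟩`. -/
lemma mvfderiv_inner (ha : IsAdaptedFrameOn S a U) {x : M} (hx : x ∈ U)
    {σ τ : (x : M) → TangentSpace (𝓡 n) x} (hσ : FieldDifferentiableAt σ x)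
    (hτ : FieldDifferentiableAt τ x) (X : TangentSpace (𝓡 n) x) :
    mvfderiv (𝓡 n) (fun y => S.metric.inner y (σ y) (τ y)) x X =
      S.metric.inner x (frameCov S a σ x X) (τ x) +
        S.metric.inner x (σ x) (frameCov S a τ x X) := by
  have h : (fun y => S.metric.inner y (σ y) (τ y)) =ᶠ[𝓝 x]
      fun y => ∑ k, S.metric.inner y (σ y) (a k y) * S.metric.inner y (τ y) (a k y) := by
    filter_upwards [ha.isOpen.mem_nhds hx] with y hy using ha.inner_eq_sum hy _ _
  have h1 (k) := mdifferentiableAt_metric S.metric hσ (ha.differentiable k hx)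
  have h2 (k) := mdifferentiableAt_metric S.metric hτ (ha.differentiable k hx)
  rw [mvfderiv_congr h, (mvfderiv_finset_sum (f := fun k y =>
    S.metric.inner y (σ y) (a k y) * S.metric.inner y (τ y) (a k y))
    fun k _ => (h1 k).mul (h2 k)).2]
  simp only [frameCov, sum_apply, ContinuousLinearMap.smulRight_apply, map_sum,
    map_smul, smul_apply, smul_eq_mul]
  rw [← Finset.sum_add_distrib]
  refine Finset.sum_congr rfl fun k _ => ?_
  have h3 := mvfderiv_mul (h1 k) (h2 k)
  have h4 := congrArg (fun L => L X) h3
  refine h4.trans ?_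
  simp only [add_apply, smul_apply, smul_eq_mul, S.metric.symm x (a k x)]
  ring

end IsAdaptedFrameOn

end FrameConnection

/-! ### Smoothness, and gluing by a partition of unity. -/

section SmoothFrameConnection

open Filter Topology

variable {n : ℕ} {M : Type*} [TopologicalSpace M] [ChartedSpace (EuclideanSpace ℝ (Fin n)) M]
  [IsManifold (𝓡 n) ∞ M]

/-- The section `T` of the bundle of endomorphisms of the tangent bundle is smooth at `x`. -/
abbrev EndomorphismSmoothAt (T : (x : M) → TangentSpace (𝓡 n) x →L[ℝ] TangentSpace (𝓡 n) x)
    (x : M) : Prop :=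
  ContMDiffAt (𝓡 n) ((𝓡 n).prod 𝓘(ℝ, EuclideanSpace ℝ (Fin n) →L[ℝ] EuclideanSpace ℝ (Fin n))) ∞
    (fun y => TotalSpace.mk' (EuclideanSpace ℝ (Fin n) →L[ℝ] EuclideanSpace ℝ (Fin n))
      (E := fun x : M => TangentSpace (𝓡 n) x →L[ℝ] TangentSpace (𝓡 n) x) y (T y)) x

lemma endomorphismSmoothAt_smulRight {φ : M → ℝ} {Y : (x : M) → TangentSpace (𝓡 n) x} {x : M}
    (hφ : ContMDiffAt (𝓡 n) 𝓘(ℝ, ℝ) ∞ φ x) (hY : FieldSmoothAt Y x) :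
    EndomorphismSmoothAt (fun y => (mvfderiv (𝓡 n) φ y).smulRight (Y y)) x := by
  refine (contMDiffAt_hom_bundle _).2 ⟨contMDiffAt_id, ?_⟩
  have h1 := hφ.mfderiv_const (m := ∞) (by simp)
  have h2 := (contMDiffAt_totalSpace.1 hY).2
  have h3 : ContMDiffAt (𝓡 n) 𝓘(ℝ, EuclideanSpace ℝ (Fin n) →L[ℝ] EuclideanSpace ℝ (Fin n)) ∞
      (fun y => ContinuousLinearMap.smulRightL ℝ (EuclideanSpace ℝ (Fin n))
        (EuclideanSpace ℝ (Fin n)) (inTangentCoordinates (𝓡 n) 𝓘(ℝ, ℝ) id φ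
        (fun y => mfderiv (𝓡 n) 𝓘(ℝ, ℝ) φ y) x y)
        (trivializationAt (EuclideanSpace ℝ (Fin n)) (TangentSpace (𝓡 n) : M → Type _) x
          ⟨y, Y y⟩).2) x :=
    (contMDiffAt_const.clm_apply h1).clm_apply h2
  refine h3.congr_of_eventuallyEq ?_
  filter_upwards [(trivializationAt (EuclideanSpace ℝ (Fin n)) (TangentSpace (𝓡 n) : M → Type _)
    x).open_baseSet.mem_nhds (mem_baseSet_trivializationAt _ _ _)] with y hy
  ext1 v
  simp only [ContinuousLinearMap.inCoordinates, inTangentCoordinates,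
    TangentBundle.continuousLinearMapAt_model_space]
  simp only [mvfderiv, ContinuousLinearMap.comp_apply, ContinuousLinearMap.smulRight_apply,
    map_smul, Trivialization.continuousLinearMapAt_apply,
    Trivialization.coe_linearMapAt_of_mem _ hy]
  rfl

variable {S : FinsleroidSpace n M}

namespace IsAdaptedFrameOn

lemma smooth_frameCov {ι : Type*} [Fintype ι] {a : Option ι → (x : M) → TangentSpace (𝓡 n) x}
    {U : Set M} (ha : IsAdaptedFrameOn S a U) {σ : (x : M) → TangentSpace (𝓡 n) x} {x : M}
    (hx : x ∈ U) (hσ : FieldSmoothAt σ x) : EndomorphismSmoothAt (frameCov S a σ) x :=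
  ContMDiffAt.sum_section fun k _ =>
    endomorphismSmoothAt_smulRight (contMDiffAt_metric S.metric hσ (ha.smooth k x hx))
      (ha.smooth k x hx)

end IsAdaptedFrameOn

/-- The average of the operators `A i` with respect to the partition of unity `ρ`. -/
noncomputable def averageCov {ι : Type*} (ρ : SmoothPartitionOfUnity ι (𝓡 n) M univ)
    (A : ι → ((x : M) → TangentSpace (𝓡 n) x) →
      (x : M) → TangentSpace (𝓡 n) x →L[ℝ] TangentSpace (𝓡 n) x)
    (σ : (x : M) → TangentSpace (𝓡 n) x) (x : M) :
    TangentSpace (𝓡 n) x →L[ℝ] TangentSpace (𝓡 n) x :=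
  ∑ i ∈ ρ.finsupport x, ρ i x • A i σ x

section Average

variable {ι : Type*} {ρ : SmoothPartitionOfUnity ι (𝓡 n) M univ} {U : ι → Set M}
  {A : ι → ((x : M) → TangentSpace (𝓡 n) x) →
    (x : M) → TangentSpace (𝓡 n) x →L[ℝ] TangentSpace (𝓡 n) x}

omit [IsManifold (𝓡 n) ∞ M] in
lemma averageCov_apply (σ : (x : M) → TangentSpace (𝓡 n) x) (x : M)
    (X : TangentSpace (𝓡 n) x) :
    averageCov ρ A σ x X = ∑ i ∈ ρ.finsupport x, ρ i x • A i σ x X := by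
  rw [averageCov, sum_apply]
  rfl

omit [IsManifold (𝓡 n) ∞ M] in
lemma mem_of_mem_finsupport (hρ : ρ.IsSubordinate U) {x : M} {i : ι} (hi : i ∈ ρ.finsupport x) :
    x ∈ U i :=
  hρ i (subset_tsupport _ ((ρ.mem_finsupport x).1 hi))

/-- The inhomogeneous term `dg ⊗ σ` of the Leibniz rule is reproduced because the weights sum to
one. -/
lemma isCovariantDerivativeOn_averageCov (hρ : ρ.IsSubordinate U)
    (hA : ∀ i, IsCovariantDerivativeOn (I := 𝓡 n) (EuclideanSpace ℝ (Fin n))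
      (V := (TangentSpace (𝓡 n) : M → Type _)) (A i) (U i)) :
    IsCovariantDerivativeOn (I := 𝓡 n) (EuclideanSpace ℝ (Fin n))
      (V := (TangentSpace (𝓡 n) : M → Type _)) (averageCov ρ A) univ where
  add {σ σ' x} hσ hσ' _ := by
    simp only [averageCov, ← Finset.sum_add_distrib, ← smul_add]
    exact Finset.sum_congr rfl fun i hi => by
      rw [(hA i).add hσ hσ' (mem_of_mem_finsupport hρ hi)]
  leibniz {σ g x} hσ hg _ := by
    have h1 : ∀ i ∈ ρ.finsupport x, ρ i x • A i (g • σ) x =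
        g x • ρ i x • A i σ x + ρ i x • (mvfderiv (𝓡 n) g x).smulRight (σ x) := fun i hi => by
      rw [(hA i).leibniz hσ hg (mem_of_mem_finsupport hρ hi), smul_add, smul_comm]
    rw [averageCov, Finset.sum_congr rfl h1, Finset.sum_add_distrib, ← Finset.smul_sum,
      ← Finset.sum_smul, ρ.sum_finsupport x (mem_univ x), one_smul, averageCov]

lemma endomorphismSmoothAt_averageCov (hU : ∀ i, IsOpen (U i)) (hρ : ρ.IsSubordinate U)
    {σ : (x : M) → TangentSpace (𝓡 n) x}
    (hA : ∀ i, ∀ x ∈ U i, EndomorphismSmoothAt (A i σ) x) (x : M) :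
    EndomorphismSmoothAt (averageCov ρ A σ) x := by
  have h1 : averageCov ρ A σ = fun x => ∑ᶠ i, ρ i x • A i σ x :=
    funext fun x => ρ.sum_finsupport_smul_eq_finsum x fun i _ => A i σ x
  rw [h1]
  refine ContMDiffAt.finsum_section_of_locallyFinite (t := fun i x => ρ i x • A i σ x) ?_
    fun i => ?_
  · refine ρ.locallyFinite.subset fun i y hy => ?_
    contrapose! hy
    simp [Function.notMem_support.1 hy]
  · exact ContMDiffOn.smul_section_of_tsupport (ρ i).contMDiff.contMDiffOn (hU i) (hρ i)
      (fun y hy => (hA i y hy).contMDiffWithinAt) x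

end Average

lemma exists_connection [T2Space M] [SecondCountableTopology M] (S : FinsleroidSpace n M) :
    ∃ cov : LinearConnection n M, CovariantDerivative.ContMDiffCovariantDerivative cov ∞ ∧
      (∀ {x : M} {σ : (x : M) → TangentSpace (𝓡 n) x}, ∀ X,
        mvfderiv (𝓡 n) (fun y => S.axis y (σ y)) x X = S.axis x (cov σ x X)) ∧
      ∀ {x : M} {σ τ : (x : M) → TangentSpace (𝓡 n) x}, FieldDifferentiableAt σ x →
        FieldDifferentiableAt τ x → ∀ X,
        mvfderiv (𝓡 n) (fun y => S.metric.inner y (σ y) (τ y)) x X =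
          S.metric.inner x (cov σ x X) (τ x) + S.metric.inner x (σ x) (cov τ x X) := by
  choose U hU a ha using exists_isAdaptedFrameOn S
  have : LocallyCompactSpace M :=
    ChartedSpace.locallyCompactSpace (EuclideanSpace ℝ (Fin n)) M
  obtain ⟨ρ, hρ⟩ := SmoothPartitionOfUnity.exists_isSubordinate (𝓡 n) isClosed_univ U
    (fun x => (ha x).isOpen) fun x _ => mem_iUnion.2 ⟨x, hU x⟩
  have hρ1 : ∀ x, ∑ i ∈ ρ.finsupport x, ρ i x = 1 := fun x => ρ.sum_finsupport x (mem_univ x)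
  refine ⟨⟨averageCov ρ fun i => frameCov S (a i),
    isCovariantDerivativeOn_averageCov hρ fun i => (ha i).isCovariantDerivativeOn⟩,
    ⟨⟨fun {σ} hσ x _ => ?_⟩⟩, fun {x σ} X => ?_, fun {x σ τ} hσ hτ X => ?_⟩
  · have hσ' : ∀ x, FieldSmoothAt σ x := fun x =>
      (hσ x (mem_univ x)).contMDiffAt Filter.univ_mem
    exact (endomorphismSmoothAt_averageCov (fun i => (ha i).isOpen) hρ
      (fun i y hy => (ha i).smooth_frameCov hy (hσ' y)) x).contMDiffWithinAt
  · change _ = S.axis x (averageCov ρ (fun i => frameCov S (a i)) σ x X)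
    rw [averageCov_apply, map_sum]
    simp only [map_smul, smul_eq_mul]
    rw [Finset.sum_congr rfl fun i hi => by
      rw [← (ha i).mvfderiv_axis (mem_of_mem_finsupport hρ hi)], ← Finset.sum_mul, hρ1, one_mul]
  · change _ = S.metric.inner x (averageCov ρ (fun i => frameCov S (a i)) σ x X) _ +
      S.metric.inner x _ (averageCov ρ (fun i => frameCov S (a i)) τ x X)
    rw [averageCov_apply, averageCov_apply, map_sum, map_sum, sum_apply]
    simp only [map_smul, smul_apply, smul_eq_mul]
    rw [← Finset.sum_add_distrib]
    simp only [← mul_add]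
    rw [Finset.sum_congr rfl fun i hi => by
      rw [← (ha i).mvfderiv_inner (mem_of_mem_finsupport hρ hi) hσ hτ],
      ← Finset.sum_mul, hρ1, one_mul]

end SmoothFrameConnection

/-! ### Constant charge implies generalized Berwald. -/

section Compatible

open Filter Topology

variable {n : ℕ} {M : Type*} [TopologicalSpace M] [ChartedSpace (EuclideanSpace ℝ (Fin n)) M]
  [IsManifold (𝓡 n) ∞ M]

variable (e : Trivialization (EuclideanSpace ℝ (Fin n))
    (TotalSpace.proj : TangentBundle (𝓡 n) M → M)) [MemTrivializationAtlas e]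

/-- The `j`-th coordinate vector field of the trivialization `e`. -/
noncomputable def coordField (j : Fin n) (x : M) : TangentSpace (𝓡 n) x :=
  e.symm x (EuclideanSpace.basisFun (Fin n) ℝ j)

lemma fieldDifferentiableAt_coordField {x : M} (hx : x ∈ e.baseSet) (j : Fin n) :
    FieldDifferentiableAt (coordField e j) x :=
  fieldDifferentiableAt_symm_const e hx _

lemma sum_smul_coordField {x : M} (hx : x ∈ e.baseSet) (c : EuclideanSpace ℝ (Fin n)) :
    ∑ j, c j • coordField e j x = e.symm x c := by
  simp only [coordField, ← e.symmL_apply (R := ℝ) hx, ← map_smul, ← map_sum]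
  congr 1
  simpa using (EuclideanSpace.basisFun (Fin n) ℝ).sum_repr c

lemma sum_smul_coordField_trivialization {x : M} (hx : x ∈ e.baseSet)
    (v : TangentSpace (𝓡 n) x) : ∑ j, (e ⟨x, v⟩).2 j • coordField e j x = v := by
  rw [sum_smul_coordField e hx, e.symm_apply_apply_mk hx]

/-- Linearity in `c` is read off from the bilinear Christoffel symbols. -/
lemma cov_symm_const_eq_sum (cov : LinearConnection n M) {x : M} (hx : x ∈ e.baseSet)
    (c : EuclideanSpace ℝ (Fin n)) (X : TangentSpace (𝓡 n) x) :
    cov (fun y => e.symm y c) x X = ∑ j, c j • cov (coordField e j) x X := by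
  have h (c : EuclideanSpace ℝ (Fin n)) : cov (fun y => e.symm y c) x X =
      e.symm x (christoffel e cov x c (e ⟨x, X⟩).2) := by
    rw [christoffel_apply e cov hx, e.symm_apply_apply_mk hx, e.symm_apply_apply_mk hx]
  have h2 (j : Fin n) : cov (coordField e j) x X = _ := h (EuclideanSpace.basisFun (Fin n) ℝ j)
  have hc : christoffel e cov x c =
      ∑ j, c j • christoffel e cov x (EuclideanSpace.basisFun (Fin n) ℝ j) := by
    conv_lhs => rw [← (EuclideanSpace.basisFun (Fin n) ℝ).sum_repr c]
    simp
  simp only [h, h2, hc, sum_apply, ← e.symmL_apply (R := ℝ) hx, map_sum, smul_apply, map_smul]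

/-- A parallel field is, near each time, a combination of the coordinate fields with
differentiable coefficients, the derivative of which is governed by the connection. -/
lemma IsParallelOn.exists_coefficients {cov : LinearConnection n M} {γ : ℝ → M} {s : Set ℝ}
    {V : (t : ℝ) → TangentSpace (𝓡 n) (γ t)} (hV : IsParallelOn cov γ V s) {t : ℝ} (hts : t ∈ s) :
    ∃ (f : Fin n → (x : M) → TangentSpace (𝓡 n) x) (c : Fin n → ℝ → ℝ) (c' : Fin n → ℝ),
      (∀ j, FieldDifferentiableAt (f j) (γ t)) ∧ (∀ j, HasDerivWithinAt (c j) (c' j) s t) ∧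
      (∀ᶠ r in 𝓝[s] t, V r = ∑ j, c j r • f j (γ r)) ∧
      ∑ j, (c' j • f j (γ t) + c j t • cov (f j) (γ t) (velocity γ s t)) = 0 := by
  set e := trivializationAt (EuclideanSpace ℝ (Fin n)) (TangentSpace (𝓡 n) : M → Type _) (γ t)
  have hx : γ t ∈ e.baseSet := mem_baseSet_trivializationAt _ _ _
  have hVt := hV.mdifferentiableOn t hts
  have hd := (differentiableWithinAt_trivialization e hVt hx).hasDerivWithinAt
  refine ⟨coordField e, fun j r => (e ⟨γ r, V r⟩).2 j,
    fun j => derivWithin (fun r => (e ⟨γ r, V r⟩).2) s t j,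
    fieldDifferentiableAt_coordField e hx, fun j => ?_, ?_, ?_⟩
  · exact ((EuclideanSpace.proj j : EuclideanSpace ℝ (Fin n) →L[ℝ] ℝ).hasFDerivAt
      |>.comp_hasDerivWithinAt t hd)
  · filter_upwards [(mdifferentiableWithinAt_base hVt).continuousWithinAt.preimage_mem_nhdsWithin
      (e.open_baseSet.mem_nhds hx)] with r hr
    exact (sum_smul_coordField_trivialization e hr (V r)).symm
  · rw [Finset.sum_add_distrib, sum_smul_coordField e hx, ← cov_symm_const_eq_sum e cov hx]
    exact hV.covDerivAlong_eq_zero t hts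

/-- Write `V = ∑ cⱼ fⱼ` locally. The product rule and `∇β = 0` turn the derivative into `β` of the
covariant derivative of `V` along `γ`, which is zero. -/
lemma IsParallelOn.hasDerivWithinAt_axis {S : FinsleroidSpace n M} {cov : LinearConnection n M}
    (haxis : ∀ {x : M} {σ : (x : M) → TangentSpace (𝓡 n) x}, ∀ X,
        mvfderiv (𝓡 n) (fun y => S.axis y (σ y)) x X = S.axis x (cov σ x X))
    {γ : ℝ → M} {s : Set ℝ}
    {V : (t : ℝ) → TangentSpace (𝓡 n) (γ t)} (hV : IsParallelOn cov γ V s) {t : ℝ} (hts : t ∈ s) :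
    HasDerivWithinAt (fun r => S.axis (γ r) (V r)) 0 s t := by
  obtain ⟨f, c, c', hf, hc, hVc, h0⟩ := hV.exists_coefficients hts
  have hγ := mdifferentiableWithinAt_base (hV.mdifferentiableOn t hts)
  have h1 := HasDerivWithinAt.fun_sum fun j (_ : j ∈ Finset.univ) =>
    (hc j).mul (hasDerivWithinAt_comp_curve (mdifferentiableAt_axis S (hf j)) hγ)
  have h2 := h1.congr_of_eventuallyEq_of_mem (f₁ := fun r => S.axis (γ r) (V r)) (by
    filter_upwards [hVc] with r hr
    simp [hr]) hts
  refine h2.congr_deriv ?_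
  have h3 := congrArg (S.axis (γ t)) h0
  simp only [map_zero, map_sum, map_add, map_smul, smul_eq_mul] at h3
  simpa only [haxis] using h3

lemma IsParallelOn.hasDerivWithinAt_metric {S : FinsleroidSpace n M} {cov : LinearConnection n M}
    (hmetric : ∀ {x : M} {σ τ : (x : M) → TangentSpace (𝓡 n) x}, FieldDifferentiableAt σ x →
        FieldDifferentiableAt τ x → ∀ X,
        mvfderiv (𝓡 n) (fun y => S.metric.inner y (σ y) (τ y)) x X =
          S.metric.inner x (cov σ x X) (τ x) + S.metric.inner x (σ x) (cov τ x X))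
    {γ : ℝ → M} {s : Set ℝ}
    {V : (t : ℝ) → TangentSpace (𝓡 n) (γ t)} (hV : IsParallelOn cov γ V s) {t : ℝ} (hts : t ∈ s) :
    HasDerivWithinAt (fun r => S.metric.inner (γ r) (V r) (V r)) 0 s t := by
  obtain ⟨f, c, c', hf, hc, hVc, h0⟩ := hV.exists_coefficients hts
  have hγ := mdifferentiableWithinAt_base (hV.mdifferentiableOn t hts)
  have hVt : V t = ∑ j, c j t • f j (γ t) := hVc.self_of_nhdsWithin hts
  have h1 := HasDerivWithinAt.fun_sum fun i (_ : i ∈ Finset.univ) =>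
    HasDerivWithinAt.fun_sum fun j (_ : j ∈ Finset.univ) =>
    ((hc i).mul (hc j)).mul
      (hasDerivWithinAt_comp_curve (mdifferentiableAt_metric S.metric (hf i) (hf j)) hγ)
  have h2 := h1.congr_of_eventuallyEq_of_mem
    (f₁ := fun r => S.metric.inner (γ r) (V r) (V r)) (by
    filter_upwards [hVc] with r hr
    simp only [hr, map_sum, sum_apply, map_smul, smul_apply, smul_eq_mul, Finset.mul_sum,
      Pi.mul_apply]
    rw [Finset.sum_comm]
    exact Finset.sum_congr rfl fun i _ => Finset.sum_congr rfl fun j _ => by ring) hts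
  refine h2.congr_deriv ?_
  set W := ∑ j, (c' j • f j (γ t) + c j t • cov (f j) (γ t) (velocity γ s t)) with hW
  have h3 : S.metric.inner (γ t) W (V t) = ∑ i, ∑ j,
      (c' i * S.metric.inner (γ t) (f i (γ t)) (f j (γ t)) +
      c i t * S.metric.inner (γ t) (cov (f i) (γ t) (velocity γ s t)) (f j (γ t))) * c j t := by
    rw [hW, hVt, map_sum (S.metric.inner (γ t)), sum_apply]
    refine Finset.sum_congr rfl fun i _ => ?_
    rw [map_sum]
    refine Finset.sum_congr rfl fun j _ => ?_
    simp only [map_add, map_smul, add_apply, smul_apply, smul_eq_mul]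
    ring
  have h4 : S.metric.inner (γ t) (V t) W = ∑ i, ∑ j, c i t *
      (c' j * S.metric.inner (γ t) (f i (γ t)) (f j (γ t)) +
      c j t * S.metric.inner (γ t) (f i (γ t)) (cov (f j) (γ t) (velocity γ s t))) := by
    rw [hW, hVt, map_sum (S.metric.inner (γ t)), sum_apply]
    refine Finset.sum_congr rfl fun i _ => ?_
    rw [map_sum]
    refine Finset.sum_congr rfl fun j _ => ?_
    simp only [map_add, map_smul, smul_apply, smul_eq_mul]
    ring
  rw [h0, map_zero, zero_apply] at h3
  rw [h0, map_zero] at h4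
  -- The target `0` is read as `⟨W, V⟩ + ⟨V, W⟩`, where `W = 0` is the covariant derivative of `V`,
  -- and the double sums are compared term by term.
  rw [← add_zero (0 : ℝ)]
  nth_rw 1 [h3]
  rw [h4, ← Finset.sum_add_distrib]
  refine Finset.sum_congr rfl fun i _ => ?_
  rw [← Finset.sum_add_distrib]
  refine Finset.sum_congr rfl fun j _ => ?_
  rw [hmetric (hf i) (hf j), Pi.mul_apply]
  ring

lemma FinsleroidSpace.isGeneralizedBerwald [T2Space M] [SecondCountableTopology M]
    (S : FinsleroidSpace n M) {c : ℝ} (hc : ∀ x, S.charge x = c) :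
    IsGeneralizedBerwald S.norm := by
  obtain ⟨cov, hcov, haxis, hmetric⟩ := exists_connection S
  refine ⟨cov, hcov, ?_⟩
  rintro γ a b hab - _ _ ⟨V, hV, rfl, rfl⟩
  have hconst {φ : ℝ → ℝ} (hφ : ∀ t ∈ Icc a b, HasDerivWithinAt φ 0 (Icc a b) t) :
      φ b = φ a :=
    constant_of_derivWithin_zero (fun t ht => (hφ t ht).differentiableWithinAt)
      (fun t ht => (hφ t (Ico_subset_Icc_self ht)).derivWithin
        (uniqueDiffOn_Icc hab t (Ico_subset_Icc_self ht))) b (right_mem_Icc.2 hab.le)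
  have h1 := hconst fun t ht => hV.hasDerivWithinAt_axis haxis ht
  have h2 := hconst fun t ht => hV.hasDerivWithinAt_metric hmetric ht
  simp only [FinsleroidSpace.norm, FinsleroidSpace.energy, hc]
  rw [h1, h2]

end Compatible

end Finsleroid

/-- A connected Finsleroid-Finsler space is a generalized Berwald space if and only if the
Finsleroid charge is constant. -/
theorem theorem9 {n : ℕ} {M : Type*} [TopologicalSpace M]
    [ChartedSpace (EuclideanSpace ℝ (Fin n)) M] [IsManifold (𝓡 n) ∞ M]
    [T2Space M] [SecondCountableTopology M] [ConnectedSpace M]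
    (S : Finsleroid.FinsleroidSpace n M) :
    Finsleroid.IsGeneralizedBerwald S.norm ↔ ∃ c : ℝ, ∀ x : M, S.charge x = c :=
  ⟨fun h => S.exists_charge_eq h, fun ⟨_, hc⟩ => S.isGeneralizedBerwald hc⟩
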